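/- Let $d$ be a prime, $n\ge 0$, and let $s,t\in\mathbb{Z}_d$ be nontrivial parameters with $s^2+t^2\equiv 1 \pmod d$, i.e. $s^2,t^2\not\equiv 0,1 \pmod d$ (so $d$ is odd). On two $n$-qudit systems $A,B$ with computational basis $|\vec i\rangle$, $\vec i\in\mathbb{Z}_d^n$, let $$U_{s,t}=\sum_{\vec i,\vec j\in\mathbb{Z}_d^n}|s\vec i+t\vec j\rangle\langle\vec i|_A\otimes|-t\vec i+s\vec j\rangle\langle\vec j|_B ,$$ and for an $n$-qudit state $\sigma$ let $\Lambda_\sigma(\rho)=\mathrm{Tr}_B\big[U_{s,t}(\rho\otimes\sigma)U_{s,t}^\dagger\big]$ be the discrete beam splitter channel with environmental state $\sigma$. For a channel $\Lambda$ and a state $\rho$ on its input with purification $\Psi_{RA}$, let $I_c(\rho,\Lambda)=S(\Lambda(\rho))-S\big((I\otimes\Lambda)(|\Psi\rangle\langle\Psi|_{RA})\big)$, where $S(\rho)=-\mathrm{Tr}(\rho\log\rho)$ with $\log=\log_2$; let $Q^{(1)}(\Lambda)=\max_\rho I_c(\rho,\Lambda)$, and let the quantum capacity be $Q(\Lambda)=\lim_{N\to\infty}\frac1N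 Q^{(1)}(\Lambda^{\otimes N})$. Let $\omega=e^{2\pi i/d}$, $X|k\rangle=|k+1\rangle$, $Z|k\rangle=\omega^k|k\rangle$, and $w(\vec p,\vec q)=\bigotimes_{i=1}^n\omega^{-2^{-1}p_iq_i}Z^{p_i}X^{q_i}$. Let $STAB$ be the set of all (pure or mixed) $n$-qudit stabilizer states, i.e. states of the form $\tau=\frac{1}{d^{n-r}}\prod_{i=1}^r\Big(\frac1d\sum_{k\in\mathbb{Z}_d}g_i^k\Big)$, where $0\le r\le n$ and $g_1,\dots,g_r$ are independent commuting Pauli operators $g_i=\omega^{c_i}w(\vec p_i,\vec q_i)$. The relative entropy of magic is $MRM(\sigma)=\min_{\tau\in STAB}D(\sigma\|\tau)$, with $D(\sigma\|\tau)=\mathrm{Tr}(\sigma\log\sigma)-\mathrm{Tr}(\sigma\log\tau)$ (equal to $+\infty$ if the support of $\sigma$ is not contained in that of $\tau$). Then, for every $n$-qudit state $\sigma$, the limit defining $Q(\Lambda_\sigma)$ exists and $$Q(\Lambda_\sigma)\le MRM(\sigma).$$ -/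

import Mathlib

open scoped Kronecker ComplexOrder

noncomputable section

namespace QuditBeamSplitter

/-! ### States, partial traces, entropies -/

section General

variable {A B R : Type*} [Fintype A] [DecidableEq A] [Fintype B] [DecidableEq B]
  [Fintype R] [DecidableEq R]

/-- Density matrices (quantum states) on `ℂ^A`. -/
def IsState (ρ : Matrix A A ℂ) : Prop := ρ.PosSemidef ∧ ρ.trace = 1

/-- Partial trace over the first tensor factor. -/
def traceFst (X : Matrix (A × B) (A × B) ℂ) : Matrix B B ℂ :=
  Matrix.of fun b b' => ∑ a, X (a, b) (a, b')

/-- Partial trace over the second tensor factor. -/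
def traceSnd (X : Matrix (A × B) (A × B) ℂ) : Matrix A A ℂ :=
  Matrix.of fun a a' => ∑ b, X (a, b) (a', b)

/-- The base-two logarithm of a Hermitian matrix, by functional calculus. Since
`Real.logb 2 0 = 0`, it vanishes on the kernel, which is the convention `0 log 0 = 0`. -/
def log2 (ρ : Matrix A A ℂ) : Matrix A A ℂ := cfc (Real.logb 2) ρ

/-- The von Neumann entropy `S(ρ) = -Tr (ρ log ρ)`. -/
def entropy (ρ : Matrix A A ℂ) : ℝ := -((ρ * log2 ρ).trace).re

open Classical in
/-- The quantum relative entropy `D(ρ‖τ) = Tr (ρ log ρ) - Tr (ρ log τ)`, which is `+∞` unless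
the support of `ρ` is contained in the support of `τ`. -/
def relEntropy (ρ τ : Matrix A A ℂ) : EReal :=
  if ∀ v : A → ℂ, τ.mulVec v = 0 → ρ.mulVec v = 0 then
    ((((ρ * log2 ρ).trace - (ρ * log2 τ).trace).re : ℝ) : EReal)
  else ⊤

/-! ### Quantum capacity -/

/-- The map `I_R ⊗ Λ` on operators on `ℂ^R ⊗ ℂ^A`. -/
def idTensor (R : Type*) (Λ : Matrix A A ℂ →ₗ[ℂ] Matrix A A ℂ) (X : Matrix (R × A) (R × A) ℂ) :
    Matrix (R × A) (R × A) ℂ :=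
  Matrix.of fun x y => Λ (Matrix.of fun a a' => X (x.1, a) (y.1, a')) x.2 y.2

/-- The tensor power `Λ^{⊗N}`: the linear map with
`|b₁⟩⟨b'₁| ⊗ ⋯ ⊗ |b_N⟩⟨b'_N| ↦ Λ(|b₁⟩⟨b'₁|) ⊗ ⋯ ⊗ Λ(|b_N⟩⟨b'_N|)`. -/
def tensorPower (Λ : Matrix A A ℂ →ₗ[ℂ] Matrix A A ℂ) (N : ℕ) :
    Matrix (Fin N → A) (Fin N → A) ℂ →ₗ[ℂ] Matrix (Fin N → A) (Fin N → A) ℂ where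
  toFun X := Matrix.of fun a a' =>
    ∑ b, ∑ b', X b b' * ∏ i, Λ (Matrix.single (b i) (b' i) 1) (a i) (a' i)
  map_add' X Y := by
    ext a a'
    simp [add_mul, Finset.sum_add_distrib]
  map_smul' c X := by
    ext a a'
    simp [mul_assoc, Finset.mul_sum]

/-- The rank-one operator `|ψ⟩⟨ψ|`. -/
def proj (ψ : A → ℂ) : Matrix A A ℂ := Matrix.vecMulVec ψ (star ψ)

/-- `ψ ∈ ℂ^R ⊗ ℂ^A` is a purification of the state `ρ` on `ℂ^A`. -/
def IsPurification (ψ : R × A → ℂ) (ρ : Matrix A A ℂ) : Prop := traceFst (proj ψ) = ρ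

/-- The coherent information `S(Λ(ρ)) - S((I ⊗ Λ)(|ψ⟩⟨ψ|))`, for a purification `ψ` of `ρ`. -/
def coherentInfo (Λ : Matrix A A ℂ →ₗ[ℂ] Matrix A A ℂ) (ρ : Matrix A A ℂ) (ψ : R × A → ℂ) : ℝ :=
  entropy (Λ ρ) - entropy (idTensor R Λ (proj ψ))

/-- The one-shot quantity `Q⁽¹⁾(Λ) = max_ρ I_c(ρ, Λ)`. Every state on `ℂ^A` has a purification
with reference system `ℂ^A`, and the coherent information does not depend on which one is used. -/
def oneShotCapacity (Λ : Matrix A A ℂ →ₗ[ℂ] Matrix A A ℂ) : ℝ :=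
  sSup {x | ∃ (ρ : Matrix A A ℂ) (ψ : A × A → ℂ),
    IsState ρ ∧ IsPurification ψ ρ ∧ x = coherentInfo Λ ρ ψ}

/-- `Q` is the limit `lim_{N → ∞} Q⁽¹⁾(Λ^{⊗N}) / N`, i.e. the quantum capacity of `Λ`. -/
def IsQuantumCapacity (Λ : Matrix A A ℂ →ₗ[ℂ] Matrix A A ℂ) (Q : ℝ) : Prop :=
  Filter.Tendsto (fun N : ℕ => oneShotCapacity (tensorPower Λ N) / (N : ℝ)) Filter.atTop (nhds Q)

end General

section Qudits

variable {d n : ℕ} [NeZero d]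

/-! ### Weyl operators and stabilizer states -/

/-- `ω_d^k`, where `ω_d = exp (2πi/d)`. -/
def omega (k : ZMod d) : ℂ := ZMod.stdAddChar k

/-- The Pauli operator `X : |k⟩ ↦ |k + 1⟩`. -/
def pauliX (d : ℕ) : Matrix (ZMod d) (ZMod d) ℂ :=
  Matrix.of fun j k => if j = k + 1 then 1 else 0

/-- The Pauli operator `Z : |k⟩ ↦ ω^k |k⟩`. -/
def pauliZ (d : ℕ) [NeZero d] : Matrix (ZMod d) (ZMod d) ℂ := Matrix.diagonal omega

/-- The one-qudit Weyl operator `w(p,q) = ω^{-2⁻¹ p q} Z^p X^q` (for odd prime `d`). -/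
def weylOne (p q : ZMod d) : Matrix (ZMod d) (ZMod d) ℂ :=
  omega (-(2⁻¹ * p * q)) • (pauliZ d ^ p.val * pauliX d ^ q.val)

/-- The `n`-qudit Weyl operator `w(p₁,q₁) ⊗ ⋯ ⊗ w(pₙ,qₙ)` at the phase space point `x = (p, q)`. -/
def weyl (x : (Fin n → ZMod d) × (Fin n → ZMod d)) :
    Matrix (Fin n → ZMod d) (Fin n → ZMod d) ℂ :=
  Matrix.of fun j k => ∏ i, weylOne (x.1 i) (x.2 i) (j i) (k i)

/-- `τ` is a (pure or mixed) stabilizer state: `τ = d^{-(n-r)} ∏_{i<r} 𝔼_{k ∈ ℤ_d} g_i^k`, for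
`r` independent commuting Pauli operators `g_i = ω^{c_i} w(x_i)`. -/
def IsStabilizerState (τ : Matrix (Fin n → ZMod d) (Fin n → ZMod d) ℂ) : Prop :=
  IsState τ ∧
  ∃ r : ℕ, r ≤ n ∧
  ∃ (x : Fin r → (Fin n → ZMod d) × (Fin n → ZMod d)) (c : Fin r → ZMod d)
    (g : Fin r → Matrix (Fin n → ZMod d) (Fin n → ZMod d) ℂ),
    LinearIndependent (ZMod d) x ∧
    (∀ i, g i = omega (c i) • weyl (x i)) ∧
    (∀ i j, Commute (g i) (g j)) ∧
    τ = ((d : ℂ) ^ (n - r))⁻¹ •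
      (List.ofFn fun i => (d : ℂ)⁻¹ • ∑ k : ZMod d, g i ^ k.val).prod

/-- The relative entropy of magic `MRM(ρ) = min_{τ ∈ STAB} D(ρ‖τ)`, where `STAB` is the (finite)
set of pure and mixed stabilizer states. -/
def MRM (ρ : Matrix (Fin n → ZMod d) (Fin n → ZMod d) ℂ) : EReal :=
  sInf {x | ∃ τ, IsStabilizerState τ ∧ x = relEntropy ρ τ}

/-! ### The discrete beam splitter -/

/-- The beam splitter unitary
`U_{s,t} = ∑_{i,j} |s i + t j⟩⟨i|_A ⊗ |-t i + s j⟩⟨j|_B` on `n + n` qudits. -/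
def beamSplitter (n : ℕ) (s t : ZMod d) :
    Matrix ((Fin n → ZMod d) × (Fin n → ZMod d)) ((Fin n → ZMod d) × (Fin n → ZMod d)) ℂ :=
  ∑ i : Fin n → ZMod d, ∑ j : Fin n → ZMod d,
    Matrix.single (s • i + t • j) i (1 : ℂ) ⊗ₖ Matrix.single (-t • i + s • j) j (1 : ℂ)

/-- The channel `Λ_σ(ρ) = Tr_B (U_{s,t} (ρ ⊗ σ) U_{s,t}†)` with environmental state `σ`. -/
def beamSplitterChannel (s t : ZMod d) (σ : Matrix (Fin n → ZMod d) (Fin n → ZMod d) ℂ) :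
    Matrix (Fin n → ZMod d) (Fin n → ZMod d) ℂ →ₗ[ℂ]
      Matrix (Fin n → ZMod d) (Fin n → ZMod d) ℂ where
  toFun ρ := traceSnd (beamSplitter n s t * (ρ ⊗ₖ σ) * (beamSplitter n s t).conjTranspose)
  map_add' ρ ρ' := by
    ext a a'
    simp [traceSnd, Matrix.add_kronecker, Matrix.mul_add, Matrix.add_mul, Finset.sum_add_distrib]
  map_smul' c ρ := by
    ext a a'
    simp [traceSnd, Matrix.smul_kronecker, Finset.mul_sum]

end Qudits

end QuditBeamSplitter

end

/-!
The capacity bound compares `σ` with a stabilizer state `τ` whose support contains that of `σ`.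
Such a `τ` is `P / D`, where `P` is the projection onto the code space of a stabilizer group `G`
and `D` its dimension, so that `D(σ‖τ) = log D - S(σ)` (`relEntropy_of_support`).

The reason for the bound is that the beam splitter with a stabilizer environment is entanglement
breaking. Convolution with a Weyl operator returns a multiple of the Weyl operator at a rescaled
phase space point (`exists_conv_phaseShift`), and a stabilizer group is closed under rescaling.
Hence for environments in the span of `G` all outputs lie in the span of `G`, a commutative
algebra; the joint output `Φ` with the reference system `R` is then separable, and
`Φ ≤ 1 ⊗ Tr_R Φ` (`one_kronecker_traceFst_sub_posSemidef`).

For a fixed purified input `ψ`, the map `N` from environment states to joint outputs on `R ⊗ B` is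
itself a quantum channel, with Kraus operators `outputKraus`. Data processing for `N`, followed by
`N(τ) ≤ 1 ⊗ ω` with `ω = Tr_R N(τ)` and Klein's inequality, gives
`D(σ‖τ) ≥ D(N(σ)‖N(τ)) ≥ D(N(σ)‖1 ⊗ ω) ≥ S(Tr_R N(σ)) - S(N(σ))`,
and the right-hand side is the coherent information (`entropy_sub_entropy_le`). To have invertible
reference operators, `τ` is replaced by `τ + ε` and `ε` tends to `0`.

Data processing (`relEntropy_krausMap_le`) is proved from scratch. The relative entropy of `(X, Y)`
is an integral over `t` of the numbers `max_Z 2 Re Tr(XZ) - Tr(Z†YZ) - t Tr(ZXZ†)`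
(`modularForm`), and each of these decreases under a channel by the Schwarz inequality for the dual
map. The variational form also absorbs the step `N(τ) ≤ 1 ⊗ ω`.

`N` independent uses of the channel form the beam splitter on `(ℤ_d^n)^N` with environment
`σ^{⊗N}` (`tensorPower_beamSplitterChannel`), and `τ^{⊗N}` is again a stabilizer state, so the
one-shot bound holds for all `N` with right-hand side `N (log D - S(σ))`. The limit exists by
Fekete's lemma: the coherent information is superadditive on product inputs
(`add_mem_infoValues`), and the trivial stabilizer group bounds it linearly in `N`.
-/

noncomputable section

namespace QuditBeamSplitter

/-! ### Spectral forms, logarithms and entropies -/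

section Spectral

open Matrix

variable {A B : Type*} [Fintype A] [DecidableEq A] [Fintype B] [DecidableEq B]

/-- The matrix `U diag(f) U†`. For unitary `U` this is a Hermitian matrix presented by an
eigenbasis (the columns of `U`) and the corresponding eigenvalues `f`. -/
def spectralForm (U : Matrix A A ℂ) (f : A → ℝ) : Matrix A A ℂ :=
  U * diagonal (fun i => (f i : ℂ)) * Uᴴ

lemma exists_spectralForm {X : Matrix A A ℂ} (hX : X.IsHermitian) :
    ∃ (U : Matrix A A ℂ) (f : A → ℝ), Uᴴ * U = 1 ∧ X = spectralForm U f := by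
  refine ⟨hX.eigenvectorUnitary, hX.eigenvalues, ?_, ?_⟩
  · exact Unitary.coe_star_mul_self hX.eigenvectorUnitary
  · conv_lhs => rw [hX.spectral_theorem]
    rw [Unitary.conjStarAlgAut_apply]
    rfl

lemma spectralForm_isHermitian (U : Matrix A A ℂ) (f : A → ℝ) :
    (spectralForm U f).IsHermitian := by
  unfold spectralForm
  apply isHermitian_mul_mul_conjTranspose
  rw [Matrix.IsHermitian, diagonal_conjTranspose]
  congr 1
  ext i
  simp

lemma cfc_spectralForm {U : Matrix A A ℂ} (hU : Uᴴ * U = 1) (f : A → ℝ) (g : ℝ → ℝ) :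
    cfc g (spectralForm U f) = spectralForm U (g ∘ f) := by
  have hX := spectralForm_isHermitian U f
  rw [hX.cfc_eq, Matrix.IsHermitian.cfc, Unitary.conjStarAlgAut_apply]
  have hs := hX.spectral_theorem
  rw [Unitary.conjStarAlgAut_apply] at hs
  set V : Matrix A A ℂ := (hX.eigenvectorUnitary : Matrix A A ℂ) with hV
  have hV1 : Vᴴ * V = 1 := Unitary.coe_star_mul_self hX.eigenvectorUnitary
  have hV2 : V * Vᴴ = 1 := mul_eq_one_comm.mp hV1
  have hU2 : U * Uᴴ = 1 := mul_eq_one_comm.mp hU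
  set l := hX.eigenvalues
  -- the change of basis `V†U` intertwines the two diagonal forms, hence all functions of them
  have h1 : diagonal (fun i => (l i : ℂ)) * (Vᴴ * U)
      = (Vᴴ * U) * diagonal (fun i => (f i : ℂ)) := by
    have hs' : U * diagonal (fun i => (f i : ℂ)) * Uᴴ = V * diagonal (fun i => (l i : ℂ)) * Vᴴ := hs
    calc diagonal (fun i => (l i : ℂ)) * (Vᴴ * U)
        = (Vᴴ * V) * diagonal (fun i => (l i : ℂ)) * (Vᴴ * U) := by rw [hV1, one_mul]
      _ = Vᴴ * (V * diagonal (fun i => (l i : ℂ)) * Vᴴ) * U := by simp only [mul_assoc]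
      _ = Vᴴ * (U * diagonal (fun i => (f i : ℂ)) * Uᴴ) * U := by rw [hs']
      _ = (Vᴴ * U) * diagonal (fun i => (f i : ℂ)) * (Uᴴ * U) := by simp only [mul_assoc]
      _ = _ := by rw [hU, mul_one]
  have h2 : diagonal (fun i => (g (l i) : ℂ)) * (Vᴴ * U)
      = (Vᴴ * U) * diagonal (fun i => (g (f i) : ℂ)) := by
    ext i j
    have := congr_fun (congr_fun h1 i) j
    rw [diagonal_mul, mul_diagonal] at this ⊢
    by_cases h0 : (Vᴴ * U) i j = 0
    · rw [h0]; simp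
    · rw [mul_comm] at this
      have h3 := mul_left_cancel₀ h0 this
      rw [Complex.ofReal_inj.mp h3, mul_comm]
  have h3 : V * diagonal (fun i => (g (l i) : ℂ)) * Vᴴ
      = U * diagonal (fun i => (g (f i) : ℂ)) * Uᴴ := by
    calc V * diagonal (fun i => (g (l i) : ℂ)) * Vᴴ
        = V * diagonal (fun i => (g (l i) : ℂ)) * Vᴴ * (U * Uᴴ) := by rw [hU2, mul_one]
      _ = V * (diagonal (fun i => (g (l i) : ℂ)) * (Vᴴ * U)) * Uᴴ := by simp only [mul_assoc]
      _ = (V * Vᴴ) * U * diagonal (fun i => (g (f i) : ℂ)) * Uᴴ := by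
        rw [h2]; simp only [mul_assoc]
      _ = _ := by rw [hV2, one_mul]
  exact h3

lemma trace_spectralForm {U : Matrix A A ℂ} (hU : Uᴴ * U = 1) (f : A → ℝ) :
    (spectralForm U f).trace = ∑ i, (f i : ℂ) := by
  rw [spectralForm, trace_mul_comm, ← mul_assoc, hU, one_mul, trace_diagonal]

lemma sum_sq_norm_row {W : Matrix A A ℂ} (hW : W * Wᴴ = 1) (i : A) : ∑ j, ‖W i j‖ ^ 2 = 1 := by
  have h := congr_fun (congr_fun hW i) i
  rw [mul_apply, one_apply_eq] at h
  have h2 : ∑ j, ((‖W i j‖ ^ 2 : ℝ) : ℂ) = 1 := by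
    rw [← h]
    refine Finset.sum_congr rfl fun j _ => ?_
    rw [conjTranspose_apply, Complex.star_def, Complex.mul_conj, Complex.normSq_eq_norm_sq]
  exact_mod_cast h2

lemma sum_sq_norm_col {W : Matrix A A ℂ} (hW : Wᴴ * W = 1) (j : A) : ∑ i, ‖W i j‖ ^ 2 = 1 := by
  have := sum_sq_norm_row (W := Wᴴ) (by rwa [conjTranspose_conjTranspose]) j
  simpa using this

lemma isometry_conjTranspose_mul {U V : Matrix A A ℂ} (hU : Uᴴ * U = 1) (hV : Vᴴ * V = 1) :
    (Uᴴ * V)ᴴ * (Uᴴ * V) = 1 := by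
  have hU2 : U * Uᴴ = 1 := mul_eq_one_comm.mp hU
  calc (Uᴴ * V)ᴴ * (Uᴴ * V) = Vᴴ * (U * Uᴴ) * V := by
        rw [conjTranspose_mul, conjTranspose_conjTranspose]; simp only [mul_assoc]
    _ = 1 := by rw [hU2, mul_one, hV]

lemma re_trace_spectralForm_mul (U V : Matrix A A ℂ) (f g : A → ℝ) :
    ((spectralForm U f * spectralForm V g).trace).re
      = ∑ i, ∑ j, ‖(Uᴴ * V) i j‖ ^ 2 * (f i * g j) := by
  have : (spectralForm U f * spectralForm V g).trace
      = (diagonal (fun i => (f i : ℂ)) * ((Uᴴ * V) * diagonal (fun i => (g i : ℂ)) *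
        (Uᴴ * V)ᴴ)).trace := by
    unfold spectralForm
    rw [mul_assoc, mul_assoc, trace_mul_comm, conjTranspose_mul, conjTranspose_conjTranspose]
    simp only [mul_assoc]
  rw [this, trace, Complex.re_sum]
  refine Finset.sum_congr rfl fun i _ => ?_
  rw [diag_apply, diagonal_mul, mul_apply, Finset.mul_sum, Complex.re_sum]
  refine Finset.sum_congr rfl fun j _ => ?_
  rw [mul_diagonal, conjTranspose_apply, Complex.star_def]
  have : (f i : ℂ) * ((Uᴴ * V) i j * (g j : ℂ) * (starRingEnd ℂ) ((Uᴴ * V) i j))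
      = ((‖(Uᴴ * V) i j‖ ^ 2 * (f i * g j) : ℝ) : ℂ) := by
    push_cast
    rw [← Complex.mul_conj']
    ring
  rw [this, Complex.ofReal_re]

lemma trace_mul_log2_self {U : Matrix A A ℂ} (hU : Uᴴ * U = 1) (f : A → ℝ) :
    ((spectralForm U f * log2 (spectralForm U f)).trace).re = ∑ i, f i * Real.logb 2 (f i) := by
  rw [log2, cfc_spectralForm hU, re_trace_spectralForm_mul, hU]
  refine Finset.sum_congr rfl fun i _ => ?_
  rw [Finset.sum_eq_single i]
  · simp
  · intro j _ hj
    simp [one_apply_ne hj.symm]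
  · simp

lemma entropy_spectralForm {U : Matrix A A ℂ} (hU : Uᴴ * U = 1) (f : A → ℝ) :
    entropy (spectralForm U f) = -∑ i, f i * Real.logb 2 (f i) := by
  rw [entropy, trace_mul_log2_self hU]

lemma trace_mul_log2 {U V : Matrix A A ℂ} (hV : Vᴴ * V = 1) (f g : A → ℝ) :
    ((spectralForm U f * log2 (spectralForm V g)).trace).re
      = ∑ i, ∑ j, ‖(Uᴴ * V) i j‖ ^ 2 * (f i * Real.logb 2 (g j)) := by
  rw [log2, cfc_spectralForm hV, re_trace_spectralForm_mul]
  rfl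

lemma spectralForm_nonneg {U : Matrix A A ℂ} (hU : Uᴴ * U = 1) {f : A → ℝ}
    (h : (spectralForm U f).PosSemidef) (i : A) : 0 ≤ f i := by
  have h1 := h.conjTranspose_mul_mul_same U
  have h2 : Uᴴ * spectralForm U f * U = diagonal (fun i => (f i : ℂ)) := by
    calc Uᴴ * spectralForm U f * U
        = (Uᴴ * U) * diagonal (fun i => (f i : ℂ)) * (Uᴴ * U) := by
          unfold spectralForm; simp only [mul_assoc]
      _ = _ := by rw [hU, one_mul, mul_one]
  rw [h2, posSemidef_diagonal_iff] at h1
  exact_mod_cast h1 i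

lemma spectralForm_pos {U : Matrix A A ℂ} (hU : Uᴴ * U = 1) {f : A → ℝ}
    (h : (spectralForm U f).PosDef) (i : A) : 0 < f i := by
  have hinj : Function.Injective U.mulVec :=
    Matrix.mulVec_injective_of_isUnit ((isUnit_iff_exists).2 ⟨Uᴴ, mul_eq_one_comm.mp hU, hU⟩)
  have h1 := h.conjTranspose_mul_mul_same hinj
  have h2 : Uᴴ * spectralForm U f * U = diagonal (fun i => (f i : ℂ)) := by
    calc Uᴴ * spectralForm U f * U
        = (Uᴴ * U) * diagonal (fun i => (f i : ℂ)) * (Uᴴ * U) := by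
          unfold spectralForm; simp only [mul_assoc]
      _ = _ := by rw [hU, one_mul, mul_one]
  rw [h2, posDef_diagonal_iff] at h1
  exact_mod_cast h1 i

/-! ### Additivity and invariance of the entropy -/

lemma kronecker_spectralForm (U : Matrix A A ℂ) (V : Matrix B B ℂ) (f : A → ℝ) (g : B → ℝ) :
    spectralForm U f ⊗ₖ spectralForm V g
      = spectralForm (U ⊗ₖ V) (fun x => f x.1 * g x.2) := by
  unfold spectralForm
  rw [conjTranspose_kronecker, mul_kronecker_mul, mul_kronecker_mul, diagonal_kronecker_diagonal]
  congr 3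
  ext x
  push_cast
  rfl

lemma kronecker_isometry {U : Matrix A A ℂ} {V : Matrix B B ℂ} (hU : Uᴴ * U = 1)
    (hV : Vᴴ * V = 1) : (U ⊗ₖ V)ᴴ * (U ⊗ₖ V) = 1 := by
  rw [conjTranspose_kronecker, ← mul_kronecker_mul, hU, hV, one_kronecker_one]

lemma entropy_kronecker {X : Matrix A A ℂ} {Y : Matrix B B ℂ} (hX : X.IsHermitian)
    (hY : Y.IsHermitian) (hX1 : X.trace = 1) (hY1 : Y.trace = 1) :
    entropy (X ⊗ₖ Y) = entropy X + entropy Y := by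
  obtain ⟨U, f, hU, rfl⟩ := exists_spectralForm hX
  obtain ⟨V, g, hV, rfl⟩ := exists_spectralForm hY
  rw [trace_spectralForm hU] at hX1
  rw [trace_spectralForm hV] at hY1
  have hf : ∑ i, f i = 1 := by exact_mod_cast hX1
  have hg : ∑ i, g i = 1 := by exact_mod_cast hY1
  rw [kronecker_spectralForm, entropy_spectralForm (kronecker_isometry hU hV),
    entropy_spectralForm hU, entropy_spectralForm hV, Fintype.sum_prod_type]
  have key : ∀ x y : ℝ, x * y * Real.logb 2 (x * y)
      = (x * Real.logb 2 x) * y + x * (y * Real.logb 2 y) := by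
    intro x y
    by_cases hx : x = 0
    · simp [hx]
    by_cases hy : y = 0
    · simp [hy]
    rw [Real.logb_mul hx hy]; ring
  simp only [key, Finset.sum_add_distrib, ← Finset.mul_sum, ← Finset.sum_mul, hf, hg]
  ring

lemma submatrix_spectralForm (e : B ≃ A) (U : Matrix A A ℂ) (f : A → ℝ) :
    (spectralForm U f).submatrix e e = spectralForm (U.submatrix e e) (f ∘ e) := by
  unfold spectralForm
  rw [conjTranspose_submatrix, ← submatrix_mul_equiv _ _ e e e, ← submatrix_mul_equiv _ _ e e e,
    submatrix_diagonal_equiv]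
  rfl

lemma entropy_submatrix (e : B ≃ A) {X : Matrix A A ℂ} (hX : X.IsHermitian) :
    entropy (X.submatrix e e) = entropy X := by
  obtain ⟨U, f, hU, rfl⟩ := exists_spectralForm hX
  have hU' : (U.submatrix e e)ᴴ * U.submatrix e e = 1 := by
    rw [conjTranspose_submatrix, submatrix_mul_equiv, hU, submatrix_one_equiv]
  rw [submatrix_spectralForm, entropy_spectralForm hU', entropy_spectralForm hU]
  congr 1
  exact e.sum_comp (fun i => f i * Real.logb 2 (f i))

end Spectral

/-! ### Data processing for the relative entropy -/

section DataProcessing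

open Matrix

variable {A B β : Type*} [Fintype A] [DecidableEq A] [Fintype B] [DecidableEq B] [Fintype β]

/-- The concave quadratic functional `2 Re Tr(X Z) - Tr(Z† Y Z) - t Tr(Z X Z†)` of `Z`, whose
maximum is a resolvent of the relative modular operator of `(X, Y)`. -/
def modularForm (t : ℝ) (X Y Z : Matrix A A ℂ) : ℝ :=
  2 * ((X * Z).trace).re - ((Zᴴ * (Y * Z)).trace).re - t * ((Z * (X * Zᴴ)).trace).re

lemma re_trace_diagonal_mul (f : A → ℝ) (X : Matrix A A ℂ) :
    ((diagonal (fun i => (f i : ℂ)) * X).trace).re = ∑ i, f i * (X i i).re := by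
  rw [trace, Complex.re_sum]
  refine Finset.sum_congr rfl fun i _ => ?_
  rw [diag_apply, diagonal_mul, Complex.re_ofReal_mul]

lemma re_trace_conj_spectralForm {U V : Matrix A A ℂ} (hU : Uᴴ * U = 1) (hV : Vᴴ * V = 1)
    (g : A → ℝ) (Z : Matrix A A ℂ) :
    (((V * Z * Uᴴ)ᴴ * (spectralForm V g * (V * Z * Uᴴ))).trace).re
      = ∑ i, ∑ j, g i * ‖Z i j‖ ^ 2 := by
  have : ((V * Z * Uᴴ)ᴴ * (spectralForm V g * (V * Z * Uᴴ))).trace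
      = (diagonal (fun i => (g i : ℂ)) * (Z * Zᴴ)).trace := by
    unfold spectralForm
    rw [conjTranspose_mul, conjTranspose_mul, conjTranspose_conjTranspose]
    calc _ = (U * (Zᴴ * (Vᴴ * V) * diagonal (fun i => (g i : ℂ)) * (Vᴴ * V) * Z * Uᴴ)).trace := by
          simp only [mul_assoc]
      _ = (Zᴴ * (diagonal (fun i => (g i : ℂ)) * Z * (Uᴴ * U))).trace := by
          rw [trace_mul_comm, hV, mul_one, mul_one]; simp only [mul_assoc]
      _ = _ := by rw [hU, mul_one, trace_mul_comm]; simp only [mul_assoc]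
  rw [this, re_trace_diagonal_mul]
  refine Finset.sum_congr rfl fun i _ => ?_
  rw [mul_apply, Complex.re_sum, Finset.mul_sum]
  refine Finset.sum_congr rfl fun j _ => ?_
  rw [conjTranspose_apply, Complex.star_def, Complex.mul_conj', ← Complex.ofReal_pow,
    Complex.ofReal_re]

lemma modularForm_spectralForm {U V : Matrix A A ℂ} (hU : Uᴴ * U = 1) (hV : Vᴴ * V = 1)
    (f g : A → ℝ) (t : ℝ) (Z : Matrix A A ℂ) :
    modularForm t (spectralForm U f) (spectralForm V g) (V * Z * Uᴴ)
      = ∑ i, ∑ j, (2 * f i * ((Uᴴ * V) i j * Z j i).re - (g j + t * f i) * ‖Z j i‖ ^ 2) := by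
  have h1 : ((spectralForm U f * (V * Z * Uᴴ)).trace).re
      = ∑ i, ∑ j, f i * ((Uᴴ * V) i j * Z j i).re := by
    have : (spectralForm U f * (V * Z * Uᴴ)).trace
        = (diagonal (fun i => (f i : ℂ)) * ((Uᴴ * V) * Z)).trace := by
      unfold spectralForm
      calc _ = (U * (diagonal (fun i => (f i : ℂ)) * (Uᴴ * V * Z) * Uᴴ)).trace := by
            simp only [mul_assoc]
        _ = (diagonal (fun i => (f i : ℂ)) * (Uᴴ * V * Z) * (Uᴴ * U)).trace := by
            rw [trace_mul_comm, mul_assoc _ Uᴴ U]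
        _ = _ := by rw [hU, mul_one]
    rw [this, re_trace_diagonal_mul]
    refine Finset.sum_congr rfl fun i _ => ?_
    rw [mul_apply, Complex.re_sum, Finset.mul_sum]
  have h2 : (((V * Z * Uᴴ)ᴴ * (spectralForm V g * (V * Z * Uᴴ))).trace).re
      = ∑ i, ∑ j, g j * ‖Z j i‖ ^ 2 := by
    rw [re_trace_conj_spectralForm hU hV, Finset.sum_comm]
  have h3 : (((V * Z * Uᴴ) * (spectralForm U f * (V * Z * Uᴴ)ᴴ)).trace).re
      = ∑ i, ∑ j, f i * ‖Z j i‖ ^ 2 := by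
    have h := re_trace_conj_spectralForm hV hU f Zᴴ
    have e : (V * Z * Uᴴ)ᴴ = U * Zᴴ * Vᴴ := by
      rw [conjTranspose_mul, conjTranspose_mul, conjTranspose_conjTranspose, mul_assoc]
    have e2 : V * Z * Uᴴ = (U * Zᴴ * Vᴴ)ᴴ := by rw [← e, conjTranspose_conjTranspose]
    rw [e, e2, h]
    simp
  rw [modularForm, h1, h2, h3, Finset.mul_sum, Finset.mul_sum, ← Finset.sum_sub_distrib,
    ← Finset.sum_sub_distrib]
  refine Finset.sum_congr rfl fun i _ => ?_
  rw [Finset.mul_sum, Finset.mul_sum, ← Finset.sum_sub_distrib, ← Finset.sum_sub_distrib]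
  refine Finset.sum_congr rfl fun j _ => ?_
  ring

/-- Together with `exists_modularForm_eq`: the maximum of `modularForm` in eigenbases of both
arguments. -/
lemma modularForm_le {U V : Matrix A A ℂ} (hU : Uᴴ * U = 1) (hV : Vᴴ * V = 1)
    {f g : A → ℝ} (hf : ∀ i, 0 ≤ f i) (hg : ∀ i, 0 < g i) {t : ℝ} (ht : 0 ≤ t)
    (Z : Matrix A A ℂ) :
    modularForm t (spectralForm U f) (spectralForm V g) Z
      ≤ ∑ i, ∑ j, ‖(Uᴴ * V) i j‖ ^ 2 * (f i ^ 2 / (g j + t * f i)) := by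
  have hU2 : U * Uᴴ = 1 := mul_eq_one_comm.mp hU
  have hV2 : V * Vᴴ = 1 := mul_eq_one_comm.mp hV
  have hZ : Z = V * (Vᴴ * Z * U) * Uᴴ := by
    calc Z = (V * Vᴴ) * Z * (U * Uᴴ) := by rw [hU2, hV2, one_mul, mul_one]
      _ = _ := by simp only [mul_assoc]
  rw [hZ, modularForm_spectralForm hU hV]
  refine Finset.sum_le_sum fun i _ => Finset.sum_le_sum fun j _ => ?_
  generalize (Vᴴ * Z * U) j i = z
  generalize (Uᴴ * V) i j = w
  have ha : 0 < g j + t * f i := add_pos_of_pos_of_nonneg (hg j) (mul_nonneg ht (hf i))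
  have hre : (w * z).re ≤ ‖w‖ * ‖z‖ := by
    rw [← norm_mul]; exact Complex.re_le_norm _
  have h1 : 2 * f i * (w * z).re ≤ 2 * f i * (‖w‖ * ‖z‖) :=
    mul_le_mul_of_nonneg_left hre (by linarith [hf i])
  have h2 : 2 * f i * (‖w‖ * ‖z‖) - (g j + t * f i) * ‖z‖ ^ 2
      ≤ ‖w‖ ^ 2 * (f i ^ 2 / (g j + t * f i)) := by
    rw [← mul_div_assoc, le_div_iff₀ ha]
    nlinarith [sq_nonneg ((g j + t * f i) * ‖z‖ - f i * ‖w‖)]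
  linarith

lemma exists_modularForm_eq {U V : Matrix A A ℂ} (hU : Uᴴ * U = 1) (hV : Vᴴ * V = 1)
    {f g : A → ℝ} (hf : ∀ i, 0 ≤ f i) (hg : ∀ i, 0 < g i) {t : ℝ} (ht : 0 ≤ t) :
    ∃ Z, modularForm t (spectralForm U f) (spectralForm V g) Z
      = ∑ i, ∑ j, ‖(Uᴴ * V) i j‖ ^ 2 * (f i ^ 2 / (g j + t * f i)) := by
  refine ⟨V * (Matrix.of fun j i => ((f i / (g j + t * f i) : ℝ) : ℂ) *
    star ((Uᴴ * V) i j)) * Uᴴ, ?_⟩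
  rw [modularForm_spectralForm hU hV]
  refine Finset.sum_congr rfl fun i _ => Finset.sum_congr rfl fun j _ => ?_
  have ha : 0 < g j + t * f i := add_pos_of_pos_of_nonneg (hg j) (mul_nonneg ht (hf i))
  rw [of_apply]
  generalize (Uᴴ * V) i j = w
  have h1 : w * (((f i / (g j + t * f i) : ℝ) : ℂ) * star w)
      = ((f i / (g j + t * f i) * ‖w‖ ^ 2 : ℝ) : ℂ) := by
    push_cast
    rw [Complex.star_def, ← Complex.mul_conj']
    ring
  rw [h1, Complex.ofReal_re, norm_mul, norm_star, Complex.norm_real, Real.norm_eq_abs,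
    abs_of_nonneg (div_nonneg (hf i) ha.le)]
  field_simp
  ring

lemma tendsto_mul_log_add_mul {l m : ℝ} (hl : 0 ≤ l) :
    Filter.Tendsto (fun T : ℝ => l * (Real.log (m + T * l) - Real.log T)) Filter.atTop
      (nhds (l * Real.log l)) := by
  rcases hl.eq_or_lt with rfl | hl
  · simp
  refine Filter.Tendsto.const_mul _ ?_
  have h1 : Filter.Tendsto (fun T : ℝ => m / T + l) Filter.atTop (nhds (0 + l)) :=
    (Filter.Tendsto.div_atTop tendsto_const_nhds Filter.tendsto_id).add_const l
  rw [zero_add] at h1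
  have h2 := h1.log hl.ne'
  refine h2.congr' ?_
  have h3 : ∀ᶠ T in Filter.atTop, 0 < m / T + l := h1.eventually (lt_mem_nhds hl)
  filter_upwards [h3, Filter.eventually_gt_atTop 0] with T hT hT0
  rw [← Real.log_div _ hT0.ne']
  · congr 1
    field_simp
  · intro h
    have : m / T + l = (m + T * l) / T := by field_simp
    rw [this, h, zero_div] at hT
    exact lt_irrefl _ hT

/-- Comparing the integrals over `t` of the resolvents `l² / (m + t l)` gives a comparison of
the logarithmic sums `l log (l / m)`. -/
lemma sum_mul_log_le_of_resolvent_le {ι κ : Type*} [Fintype ι] [Fintype κ]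
    {c l m : ι → ℝ} {c' l' m' : κ → ℝ} (hl : ∀ i, 0 ≤ l i) (hm : ∀ i, 0 < m i)
    (hl' : ∀ i, 0 ≤ l' i) (hm' : ∀ i, 0 < m' i)
    (hsum : ∑ i, c i * l i = ∑ k, c' k * l' k)
    (h : ∀ t : ℝ, 0 ≤ t → ∑ k, c' k * (l' k ^ 2 / (m' k + t * l' k))
      ≤ ∑ i, c i * (l i ^ 2 / (m i + t * l i))) :
    ∑ k, c' k * (l' k * (Real.log (l' k) - Real.log (m' k)))
      ≤ ∑ i, c i * (l i * (Real.log (l i) - Real.log (m i))) := by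
  let H : ℝ → ℝ := fun T => (∑ i, c i * (l i * (Real.log (m i + T * l i) - Real.log (m i))))
    - ∑ k, c' k * (l' k * (Real.log (m' k + T * l' k) - Real.log (m' k)))
  have hd : ∀ {a b x : ℝ}, 0 ≤ a → 0 < b → 0 ≤ x →
      HasDerivAt (fun T => a * (Real.log (b + T * a) - Real.log b)) (a ^ 2 / (b + x * a)) x := by
    intro a b x ha hb hx
    have h0 : 0 < b + x * a := add_pos_of_pos_of_nonneg hb (mul_nonneg hx ha)
    have h1 : HasDerivAt (fun T : ℝ => b + T * a) a x := by
      simpa using ((hasDerivAt_id x).mul_const a).const_add b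
    exact (((h1.log h0.ne').sub_const (Real.log b)).const_mul a).congr_deriv (by ring)
  have hH : ∀ x, 0 ≤ x → HasDerivAt H ((∑ i, c i * (l i ^ 2 / (m i + x * l i)))
      - ∑ k, c' k * (l' k ^ 2 / (m' k + x * l' k))) x := by
    intro x hx
    refine HasDerivAt.sub ?_ ?_
    · exact HasDerivAt.fun_sum fun i _ => (hd (hl i) (hm i) hx).const_mul (c i)
    · exact HasDerivAt.fun_sum fun i _ => (hd (hl' i) (hm' i) hx).const_mul (c' i)
  have hmono : MonotoneOn H (Set.Ici 0) := by
    refine monotoneOn_of_deriv_nonneg (convex_Ici 0)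
      (fun x hx => (hH x hx).continuousAt.continuousWithinAt)
      (fun x hx => ?_) (fun x hx => ?_)
    · rw [interior_Ici] at hx
      exact (hH x (le_of_lt hx)).differentiableAt.differentiableWithinAt
    · rw [interior_Ici] at hx
      rw [(hH x (le_of_lt hx)).deriv]
      exact sub_nonneg.mpr (h x (le_of_lt hx))
  have hH0 : H 0 = 0 := by simp [H]
  have hpos : ∀ T, 0 ≤ T → 0 ≤ H T := fun T hT => by
    rw [← hH0]; exact hmono Set.self_mem_Ici hT hT
  -- the divergent contribution `log T` has the same weight on both sides
  have hlim : Filter.Tendsto H Filter.atTop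
      (nhds ((∑ i, c i * (l i * (Real.log (l i) - Real.log (m i))))
        - ∑ k, c' k * (l' k * (Real.log (l' k) - Real.log (m' k))))) := by
    have e : H = fun T => (∑ i, c i * (l i * (Real.log (m i + T * l i) - Real.log T)
          - l i * Real.log (m i)))
        - ∑ k, c' k * (l' k * (Real.log (m' k + T * l' k) - Real.log T)
          - l' k * Real.log (m' k)) := by
      ext T
      have e1 : ∀ {α : Type _} [Fintype α] (c l m : α → ℝ),
          ∑ i, c i * (l i * (Real.log (m i + T * l i) - Real.log (m i)))
          = (∑ i, c i * (l i * (Real.log (m i + T * l i) - Real.log T) - l i * Real.log (m i)))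
            + (∑ i, c i * l i) * Real.log T := by
        intro α _ c l m
        rw [Finset.sum_mul, ← Finset.sum_add_distrib]
        refine Finset.sum_congr rfl fun i _ => by ring
      have e2 := e1 c l m
      have e3 : ∑ i, c' i * (l' i * (Real.log (m' i + T * l' i) - Real.log (m' i)))
          = (∑ i, c' i * (l' i * (Real.log (m' i + T * l' i) - Real.log T)
            - l' i * Real.log (m' i))) + (∑ i, c' i * l' i) * Real.log T := by
        rw [Finset.sum_mul, ← Finset.sum_add_distrib]
        refine Finset.sum_congr rfl fun i _ => by ring
      simp only [H]
      rw [e2, e3, hsum]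
      ring
    rw [e]
    refine Filter.Tendsto.sub ?_ ?_
    · refine tendsto_finsetSum _ fun i _ => ?_
      rw [mul_sub (l i)]
      exact ((tendsto_mul_log_add_mul (hl i)).sub_const _).const_mul _
    · refine tendsto_finsetSum _ fun i _ => ?_
      rw [mul_sub (l' i)]
      exact ((tendsto_mul_log_add_mul (hl' i)).sub_const _).const_mul _
  have := ge_of_tendsto hlim (Filter.eventually_ge_atTop 0 |>.mono hpos)
  linarith

/-- The completely positive map `X ↦ ∑ b, K b X (K b)†`. -/
def krausMap (K : β → Matrix B A ℂ) (X : Matrix A A ℂ) : Matrix B B ℂ :=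
  ∑ b, K b * X * (K b)ᴴ

omit [DecidableEq A] [DecidableEq B] in
lemma krausMap_posSemidef (K : β → Matrix B A ℂ) {X : Matrix A A ℂ} (hX : X.PosSemidef) :
    (krausMap K X).PosSemidef :=
  Matrix.posSemidef_sum _ fun b _ => hX.mul_mul_conjTranspose_same (K b)

omit [DecidableEq A] [DecidableEq B] in
lemma krausMap_trace_mul (K : β → Matrix B A ℂ) (X : Matrix A A ℂ) (Y : Matrix B B ℂ) :
    (krausMap K X * Y).trace = (X * ∑ b, (K b)ᴴ * Y * K b).trace := by
  rw [krausMap, Finset.sum_mul, Finset.mul_sum, trace_sum, trace_sum]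
  refine Finset.sum_congr rfl fun b _ => ?_
  rw [Matrix.mul_assoc, Matrix.mul_assoc, trace_mul_comm]
  simp only [Matrix.mul_assoc]

lemma trace_krausMap {K : β → Matrix B A ℂ} (hK : ∑ b, (K b)ᴴ * K b = 1) (X : Matrix A A ℂ) :
    (krausMap K X).trace = X.trace := by
  have := krausMap_trace_mul K X 1
  simpa [hK] using this

omit [DecidableEq B] in
/-- The Schwarz inequality for the unital completely positive map dual to `krausMap K`. -/
lemma krausDual_schwarz {K : β → Matrix B A ℂ} (hK : ∑ b, (K b)ᴴ * K b = 1)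
    (Y : Matrix B B ℂ) :
    ((∑ b, (K b)ᴴ * (Yᴴ * Y) * K b)
      - (∑ b, (K b)ᴴ * Y * K b)ᴴ * (∑ b, (K b)ᴴ * Y * K b)).PosSemidef := by
  set X := ∑ b, (K b)ᴴ * Y * K b with hX
  have hXH : Xᴴ = ∑ b, (K b)ᴴ * Yᴴ * K b := by
    rw [hX, conjTranspose_sum]
    refine Finset.sum_congr rfl fun b _ => ?_
    rw [conjTranspose_mul, conjTranspose_mul, conjTranspose_conjTranspose, Matrix.mul_assoc]
  have h : (∑ b, (K b)ᴴ * (Yᴴ * Y) * K b) - Xᴴ * X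
      = ∑ b, (Y * K b - K b * X)ᴴ * (Y * K b - K b * X) := by
    have e : ∀ b, (Y * K b - K b * X)ᴴ * (Y * K b - K b * X)
        = (K b)ᴴ * (Yᴴ * Y) * K b - ((K b)ᴴ * Yᴴ * K b) * X - Xᴴ * ((K b)ᴴ * Y * K b)
          + Xᴴ * ((K b)ᴴ * K b) * X := by
      intro b
      rw [conjTranspose_sub, conjTranspose_mul, conjTranspose_mul]
      simp only [Matrix.sub_mul, Matrix.mul_sub, Matrix.mul_assoc]
      abel
    simp only [e, Finset.sum_add_distrib, Finset.sum_sub_distrib, ← Finset.sum_mul,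
      ← Finset.mul_sum]
    rw [← hXH, ← hX, hK, mul_one]
    abel
  rw [h]
  exact Matrix.posSemidef_sum _ fun b _ => Matrix.posSemidef_conjTranspose_mul_self _

lemma re_trace_mul_nonneg {X Y : Matrix A A ℂ} (hX : X.PosSemidef) (hY : Y.PosSemidef) :
    0 ≤ ((X * Y).trace).re := by
  obtain ⟨U, f, hU, rfl⟩ := exists_spectralForm hX.isHermitian
  have hf := spectralForm_nonneg hU hX
  have h : (spectralForm U f * Y).trace
      = (diagonal (fun i => (f i : ℂ)) * (Uᴴ * Y * U)).trace := by
    unfold spectralForm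
    rw [mul_assoc, mul_assoc, trace_mul_comm]
    simp only [mul_assoc]
  rw [h, re_trace_diagonal_mul]
  refine Finset.sum_nonneg fun i _ => mul_nonneg (hf i) ?_
  have := (hY.conjTranspose_mul_mul_same U).diag_nonneg (i := i)
  exact (Complex.nonneg_iff.mp this).1

lemma modularForm_krausMap_le {K : β → Matrix B A ℂ} (hK : ∑ b, (K b)ᴴ * K b = 1)
    {X T : Matrix A A ℂ} {S : Matrix B B ℂ} (hX : X.PosSemidef) (hT : T.PosSemidef)
    (hTS : (S - krausMap K T).PosSemidef) {t : ℝ} (ht : 0 ≤ t) (Z : Matrix B B ℂ) :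
    modularForm t (krausMap K X) S Z ≤ modularForm t X T (∑ b, (K b)ᴴ * Z * K b) := by
  set W := ∑ b, (K b)ᴴ * Z * K b with hW
  have hWH : Wᴴ = ∑ b, (K b)ᴴ * Zᴴ * K b := by
    rw [hW, conjTranspose_sum]
    refine Finset.sum_congr rfl fun b _ => ?_
    rw [conjTranspose_mul, conjTranspose_mul, conjTranspose_conjTranspose, Matrix.mul_assoc]
  have h1 : (krausMap K X * Z).trace = (X * W).trace := krausMap_trace_mul K X Z
  have h2 : ((Wᴴ * (T * W)).trace).re ≤ ((Zᴴ * (S * Z)).trace).re := by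
    have e1 := re_trace_mul_nonneg hTS (Matrix.posSemidef_self_mul_conjTranspose Z)
    have e2 := krausDual_schwarz hK Zᴴ
    rw [conjTranspose_conjTranspose, ← hWH, conjTranspose_conjTranspose] at e2
    have e3 := re_trace_mul_nonneg hT e2
    rw [Matrix.mul_sub, trace_sub, Complex.sub_re, ← krausMap_trace_mul] at e3
    rw [Matrix.sub_mul, trace_sub, Complex.sub_re] at e1
    have e4 : (Wᴴ * (T * W)).trace = (T * (W * Wᴴ)).trace := by
      rw [trace_mul_comm]; simp only [mul_assoc]
    have e5 : (Zᴴ * (S * Z)).trace = (S * (Z * Zᴴ)).trace := by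
      rw [trace_mul_comm]; simp only [mul_assoc]
    rw [e4, e5]
    linarith
  have h3 : ((W * (X * Wᴴ)).trace).re ≤ ((Z * (krausMap K X * Zᴴ)).trace).re := by
    have e3 := re_trace_mul_nonneg hX (krausDual_schwarz hK Z)
    rw [Matrix.mul_sub, trace_sub, Complex.sub_re, ← krausMap_trace_mul] at e3
    have e4 : (W * (X * Wᴴ)).trace = (X * (Wᴴ * W)).trace := by
      rw [trace_mul_comm]; simp only [mul_assoc]
    have e5 : (Z * (krausMap K X * Zᴴ)).trace = (krausMap K X * (Zᴴ * Z)).trace := by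
      rw [trace_mul_comm]; simp only [mul_assoc]
    rw [e4, e5]
    linarith
  unfold modularForm
  rw [h1]
  nlinarith [mul_le_mul_of_nonneg_left h3 ht]

lemma re_trace_sub_trace_log2 {U V : Matrix A A ℂ} (hU : Uᴴ * U = 1) (hV : Vᴴ * V = 1)
    (f g : A → ℝ) :
    ((spectralForm U f * log2 (spectralForm U f)).trace
      - (spectralForm U f * log2 (spectralForm V g)).trace).re
      = (∑ x : A × A, ‖(Uᴴ * V) x.1 x.2‖ ^ 2 *
        (f x.1 * (Real.log (f x.1) - Real.log (g x.2)))) / Real.log 2 := by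
  have hW := mul_eq_one_comm.mp (isometry_conjTranspose_mul hU hV)
  rw [Complex.sub_re, trace_mul_log2_self hU, trace_mul_log2 hV, Fintype.sum_prod_type,
    Finset.sum_div, ← Finset.sum_sub_distrib]
  refine Finset.sum_congr rfl fun i _ => ?_
  have : f i * Real.logb 2 (f i)
      = ∑ j, ‖(Uᴴ * V) i j‖ ^ 2 * (f i * Real.logb 2 (f i)) := by
    rw [← Finset.sum_mul, sum_sq_norm_row hW, one_mul]
  rw [this, ← Finset.sum_sub_distrib, Finset.sum_div]
  refine Finset.sum_congr rfl fun j _ => ?_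
  simp only [Real.logb]
  ring

/-- The data processing inequality for the relative entropy, for the channel `krausMap K`. The
second argument may moreover be increased after the channel has acted. -/
theorem relEntropy_krausMap_le {K : β → Matrix B A ℂ} (hK : ∑ b, (K b)ᴴ * K b = 1)
    {X T : Matrix A A ℂ} {S : Matrix B B ℂ} (hX : X.PosSemidef) (hT : T.PosDef) (hS : S.PosDef)
    (hTS : (S - krausMap K T).PosSemidef) :
    ((krausMap K X * log2 (krausMap K X)).trace - (krausMap K X * log2 S).trace).re
      ≤ ((X * log2 X).trace - (X * log2 T).trace).re := by
  have hY := krausMap_posSemidef K hX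
  have hform : ∀ (t : ℝ), 0 ≤ t → ∀ Z, modularForm t (krausMap K X) S Z
      ≤ modularForm t X T (∑ b, (K b)ᴴ * Z * K b) :=
    fun t ht Z => modularForm_krausMap_le hK hX hT.posSemidef hTS ht Z
  have htr := trace_krausMap hK X
  generalize krausMap K X = Y at hY hform htr
  obtain ⟨U, f, hU, rfl⟩ := exists_spectralForm hX.isHermitian
  obtain ⟨V, g, hV, rfl⟩ := exists_spectralForm hT.isHermitian
  obtain ⟨U', f', hU', rfl⟩ := exists_spectralForm hY.isHermitian
  obtain ⟨V', g', hV', rfl⟩ := exists_spectralForm hS.isHermitian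
  have hf := spectralForm_nonneg hU hX
  have hf' := spectralForm_nonneg hU' hY
  have hg := spectralForm_pos hV hT
  have hg' := spectralForm_pos hV' hS
  rw [re_trace_sub_trace_log2 hU hV, re_trace_sub_trace_log2 hU' hV']
  refine div_le_div_of_nonneg_right ?_ (Real.log_nonneg one_le_two)
  rw [trace_spectralForm hU, trace_spectralForm hU'] at htr
  have htr' : ∑ i, f' i = ∑ i, f i := by exact_mod_cast htr
  refine sum_mul_log_le_of_resolvent_le (fun x => hf x.1) (fun x => hg x.2) (fun x => hf' x.1)
    (fun x => hg' x.2) ?_ ?_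
  · have hW := mul_eq_one_comm.mp (isometry_conjTranspose_mul hU hV)
    have hW' := mul_eq_one_comm.mp (isometry_conjTranspose_mul hU' hV')
    rw [Fintype.sum_prod_type, Fintype.sum_prod_type]
    simp only [← Finset.sum_mul, sum_sq_norm_row hW, sum_sq_norm_row hW', one_mul]
    exact htr'.symm
  · intro t ht
    rw [Fintype.sum_prod_type, Fintype.sum_prod_type]
    obtain ⟨Z, hZ⟩ := exists_modularForm_eq hU' hV' hf' hg' ht
    rw [← hZ]
    exact (hform t ht Z).trans (modularForm_le hU hV hf hg ht _)

/-- Klein's inequality, without normalization of the second argument. -/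
theorem klein_inequality {X T : Matrix A A ℂ} (hX : X.PosSemidef) (hT : T.PosDef) :
    (X.trace.re - T.trace.re) / Real.log 2
      ≤ ((X * log2 X).trace - (X * log2 T).trace).re := by
  obtain ⟨U, f, hU, rfl⟩ := exists_spectralForm hX.isHermitian
  obtain ⟨V, g, hV, rfl⟩ := exists_spectralForm hT.isHermitian
  have hf := spectralForm_nonneg hU hX
  have hg := spectralForm_pos hV hT
  have hW := isometry_conjTranspose_mul hU hV
  rw [re_trace_sub_trace_log2 hU hV]
  refine div_le_div_of_nonneg_right ?_ (Real.log_nonneg one_le_two)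
  rw [trace_spectralForm hU, trace_spectralForm hV, ← Complex.ofReal_sum, ← Complex.ofReal_sum,
    Complex.ofReal_re, Complex.ofReal_re]
  have h1 : ∑ i, f i = ∑ x : A × A, ‖(Uᴴ * V) x.1 x.2‖ ^ 2 * f x.1 := by
    rw [Fintype.sum_prod_type]
    simp only [← Finset.sum_mul, sum_sq_norm_row (mul_eq_one_comm.mp hW), one_mul]
  have h2 : ∑ i, g i = ∑ x : A × A, ‖(Uᴴ * V) x.1 x.2‖ ^ 2 * g x.2 := by
    rw [Fintype.sum_prod_type, Finset.sum_comm]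
    simp only [← Finset.sum_mul, sum_sq_norm_col hW, one_mul]
  rw [h1, h2, ← Finset.sum_sub_distrib]
  refine Finset.sum_le_sum fun x _ => ?_
  rw [← mul_sub]
  refine mul_le_mul_of_nonneg_left ?_ (sq_nonneg _)
  generalize x.1 = i
  generalize x.2 = j
  rcases (hf i).eq_or_lt with h0 | h0
  · rw [← h0]; simp [(hg j).le]
  · have := Real.log_le_sub_one_of_pos (div_pos (hg j) h0)
    rw [Real.log_div (hg j).ne' h0.ne'] at this
    have h3 := mul_le_mul_of_nonneg_left this h0.le
    have h4 : f i * (g j / f i - 1) = g j - f i := by field_simp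
    rw [h4] at h3
    linarith

end DataProcessing

/-! ### Representations of finite abelian groups and separable operators -/

section Representation

open Matrix

variable {V R K : Type*} [Fintype V] [DecidableEq V] [Fintype R] [DecidableEq R]
  [AddCommGroup K] [Fintype K] [DecidableEq K]

/-- A unitary representation of the additive group `K` on `ℂ^V`. -/
structure IsUnitaryRep (G : K → Matrix V V ℂ) : Prop where
  map_add : ∀ k l, G (k + l) = G k * G l
  unitary : ∀ k, (G k)ᴴ * G k = 1

namespace IsUnitaryRep

variable {G : K → Matrix V V ℂ} (hG : IsUnitaryRep G)
include hG

omit [Fintype K] [DecidableEq K] in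
lemma map_zero : G 0 = 1 := by
  have h := hG.map_add 0 0
  have h1 := hG.unitary 0
  rw [add_zero] at h
  calc G 0 = (G 0)ᴴ * G 0 * G 0 := by rw [h1, one_mul]
    _ = (G 0)ᴴ * (G 0 * G 0) := by rw [mul_assoc]
    _ = 1 := by rw [← h, h1]

omit [Fintype K] [DecidableEq K] in
lemma conjTranspose_eq (k : K) : (G k)ᴴ = G (-k) := by
  calc (G k)ᴴ = (G k)ᴴ * (G k * G (-k)) := by
        rw [← hG.map_add, add_neg_cancel, hG.map_zero, mul_one]
    _ = G (-k) := by rw [← mul_assoc, hG.unitary, one_mul]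

end IsUnitaryRep

/-- The projection onto the `χ`-isotypic subspace of the representation `G`. -/
def isotypicProj (G : K → Matrix V V ℂ) (χ : AddChar K ℂ) : Matrix V V ℂ :=
  (Fintype.card K : ℂ)⁻¹ • ∑ k, χ (-k) • G k

namespace IsUnitaryRep

variable {G : K → Matrix V V ℂ} (hG : IsUnitaryRep G)
include hG

omit [DecidableEq K] in
lemma mul_isotypicProj (k : K) (χ : AddChar K ℂ) :
    G k * isotypicProj G χ = χ k • isotypicProj G χ := by
  rw [isotypicProj, mul_smul_comm, smul_comm]
  congr 1
  rw [Finset.mul_sum, Finset.smul_sum]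
  rw [← Equiv.sum_comp (Equiv.addLeft k) (fun l => χ k • χ (-l) • G l)]
  refine Finset.sum_congr rfl fun l _ => ?_
  rw [mul_smul_comm, ← hG.map_add, Equiv.coe_addLeft, smul_smul, ← AddChar.map_add_eq_mul]
  rw [show k + -(k + l) = -l by abel]

omit [DecidableEq K] in
lemma isotypicProj_mul (χ φ : AddChar K ℂ) :
    isotypicProj G χ * isotypicProj G φ = if χ = φ then isotypicProj G φ else 0 := by
  have h : isotypicProj G χ * isotypicProj G φ
      = ((Fintype.card K : ℂ)⁻¹ * ∑ k, (φ - χ) k) • isotypicProj G φ := by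
    conv_lhs => rw [isotypicProj, smul_mul_assoc, Finset.sum_mul]
    rw [← smul_smul, Finset.sum_smul]
    congr 1
    refine Finset.sum_congr rfl fun k _ => ?_
    rw [smul_mul_assoc, hG.mul_isotypicProj, smul_smul, AddChar.sub_apply', div_eq_mul_inv,
      AddChar.map_neg_eq_inv, mul_comm]
  rw [h, AddChar.sum_eq_ite]
  by_cases hχ : χ = φ
  · rw [if_pos (by rw [hχ, sub_self]), if_pos hχ, inv_mul_cancel₀, one_smul]
    exact_mod_cast Fintype.card_ne_zero
  · rw [if_neg (by rw [sub_eq_zero]; exact fun h => hχ h.symm), if_neg hχ, mul_zero, zero_smul]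

omit [DecidableEq K] in
lemma isotypicProj_isHermitian (χ : AddChar K ℂ) : (isotypicProj G χ).IsHermitian := by
  rw [Matrix.IsHermitian, isotypicProj, conjTranspose_smul, conjTranspose_sum]
  congr 1
  · simp
  rw [← Equiv.sum_comp (Equiv.neg K)]
  refine Finset.sum_congr rfl fun k _ => ?_
  rw [Equiv.neg_apply, conjTranspose_smul, hG.conjTranspose_eq, Complex.star_def,
    ← AddChar.map_neg_eq_conj, neg_neg, neg_neg]

omit [DecidableEq K] in
lemma isotypicProj_posSemidef (χ : AddChar K ℂ) : (isotypicProj G χ).PosSemidef := by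
  have h : isotypicProj G χ = (isotypicProj G χ)ᴴ * isotypicProj G χ := by
    rw [hG.isotypicProj_isHermitian χ, hG.isotypicProj_mul, if_pos rfl]
  rw [h]
  exact posSemidef_conjTranspose_mul_self _

omit hG in
omit [Fintype V] [DecidableEq V] in
lemma eq_sum_isotypicProj (k : K) : G k = ∑ χ : AddChar K ℂ, χ k • isotypicProj G χ := by
  simp only [isotypicProj, Finset.smul_sum, smul_smul]
  rw [Finset.sum_comm]
  have : ∀ l : K, ∑ χ : AddChar K ℂ, (χ k * ((Fintype.card K : ℂ)⁻¹ * χ (-l))) • G l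
      = if l = k then G k else 0 := by
    intro l
    rw [← Finset.sum_smul]
    have e : ∀ χ : AddChar K ℂ, χ k * ((Fintype.card K : ℂ)⁻¹ * χ (-l))
        = (Fintype.card K : ℂ)⁻¹ * χ (k - l) := by
      intro χ
      rw [sub_eq_add_neg, AddChar.map_add_eq_mul]; ring
    simp only [e]
    rw [← Finset.mul_sum, AddChar.sum_apply_eq_ite]
    by_cases h : l = k
    · rw [if_pos (by rw [h, sub_self]), if_pos h, inv_mul_cancel₀, one_smul, h]
      exact_mod_cast Fintype.card_ne_zero
    · rw [if_neg (by rw [sub_eq_zero]; exact fun h' => h h'.symm), if_neg h, mul_zero, zero_smul]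
  simp only [this, Finset.sum_ite_eq', Finset.mem_univ, if_true]

end IsUnitaryRep

lemma trace_smul_one_sub_posSemidef {X : Matrix R R ℂ} (hX : X.PosSemidef) :
    (X.trace • (1 : Matrix R R ℂ) - X).PosSemidef := by
  obtain ⟨U, f, hU, rfl⟩ := exists_spectralForm hX.isHermitian
  have hf := spectralForm_nonneg hU hX
  have h : (spectralForm U f).trace • (1 : Matrix R R ℂ) - spectralForm U f
      = U * diagonal (fun i => (((∑ j, f j) - f i : ℝ) : ℂ)) * Uᴴ := by
    have : diagonal (fun i => (((∑ j, f j) - f i : ℝ) : ℂ))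
        = (∑ j, (f j : ℂ)) • (1 : Matrix R R ℂ) - diagonal (fun i => (f i : ℂ)) := by
      rw [smul_one_eq_diagonal, diagonal_sub]
      congr 1; ext i; push_cast; rfl
    rw [this, trace_spectralForm hU, spectralForm, mul_sub, sub_mul, mul_smul_comm, mul_one,
      smul_mul_assoc, mul_eq_one_comm.mp hU]
  rw [h]
  refine PosSemidef.mul_mul_conjTranspose_same (posSemidef_diagonal_iff.mpr fun i => ?_) U
  have := Finset.single_le_sum (fun j _ => hf j) (Finset.mem_univ i)
  exact_mod_cast sub_nonneg.mpr this

omit [Fintype V] [DecidableEq V] [DecidableEq R] in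
lemma traceFst_kronecker (X : Matrix R R ℂ) (Y : Matrix V V ℂ) :
    traceFst (X ⊗ₖ Y) = X.trace • Y := by
  ext a b
  simp [traceFst, kroneckerMap_apply, trace, Finset.sum_mul]

/-- A positive operator whose blocks lie in the commutative algebra spanned by a representation
of a finite abelian group is separable, `X = ∑ χ, D_χ ⊗ P_χ`, and hence dominated by
`1 ⊗ Tr_R X`. -/
theorem one_kronecker_traceFst_sub_posSemidef {G : K → Matrix V V ℂ} (hG : IsUnitaryRep G)
    {X : Matrix (R × V) (R × V) ℂ} (hX : X.PosSemidef)
    (hspan : ∀ r r', (Matrix.of fun a a' => X (r, a) (r', a')) ∈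
      Submodule.span ℂ (Set.range G)) :
    ((1 : Matrix R R ℂ) ⊗ₖ traceFst X - X).PosSemidef := by
  have h1 : ∀ r r', ∃ c : K → ℂ, ∑ k, c k • G k = Matrix.of fun a a' => X (r, a) (r', a') :=
    fun r r' => (Submodule.mem_span_range_iff_exists_fun ℂ).mp (hspan r r')
  choose C hC using h1
  let D : AddChar K ℂ → Matrix R R ℂ := fun χ => Matrix.of fun r r' => ∑ k, C r r' k * χ k
  have hXD : X = ∑ χ, D χ ⊗ₖ isotypicProj G χ := by
    ext ⟨r, a⟩ ⟨r', a'⟩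
    have h2 := congr_fun (congr_fun (hC r r') a) a'
    rw [of_apply] at h2
    rw [← h2, Matrix.sum_apply, Matrix.sum_apply]
    simp only [kroneckerMap_apply, D, of_apply, Finset.sum_mul]
    rw [Finset.sum_comm]
    refine Finset.sum_congr rfl fun k _ => ?_
    conv_lhs => rw [IsUnitaryRep.eq_sum_isotypicProj (G := G) k]
    rw [Matrix.smul_apply, Matrix.sum_apply, Finset.smul_sum]
    refine Finset.sum_congr rfl fun χ _ => ?_
    rw [Matrix.smul_apply, smul_eq_mul, smul_eq_mul, mul_assoc]
  have hD : ∀ χ, isotypicProj G χ ≠ 0 → (D χ).PosSemidef := by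
    intro χ hχ
    obtain ⟨v, hv⟩ : ∃ v, isotypicProj G χ *ᵥ v ≠ 0 := by
      by_contra! h
      exact hχ (Matrix.ext_of_mulVec_single fun i => by rw [h, zero_mulVec])
    set w := isotypicProj G χ *ᵥ v with hw
    have hPw : ∀ φ, isotypicProj G φ *ᵥ w = if φ = χ then w else 0 := by
      intro φ
      rw [hw, mulVec_mulVec, hG.isotypicProj_mul]
      split_ifs
      · rfl
      · rw [zero_mulVec]
    -- compressing `X` by a vector of the `χ`-sector picks out a positive multiple of `D χ`
    let W : Matrix (R × V) R ℂ := Matrix.of fun x r => if x.1 = r then w x.2 else 0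
    have hcomp : ∀ (Y : Matrix R R ℂ) (Z : Matrix V V ℂ),
        Wᴴ * (Y ⊗ₖ Z) * W = (star w ⬝ᵥ (Z *ᵥ w)) • Y := by
      intro Y Z
      ext r r'
      rw [Matrix.mul_assoc, mul_apply, Fintype.sum_prod_type, Finset.sum_eq_single r]
      · simp only [mul_apply, Fintype.sum_prod_type, W, conjTranspose_apply, of_apply,
          kroneckerMap_apply, if_true, Matrix.smul_apply, smul_eq_mul, dotProduct, mulVec,
          Pi.star_apply]
        rw [Finset.sum_mul]
        refine Finset.sum_congr rfl fun a _ => ?_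
        rw [Finset.sum_eq_single r', mul_assoc]
        · congr 1
          rw [Finset.sum_mul]
          refine Finset.sum_congr rfl fun b _ => ?_
          rw [if_pos rfl]; ring
        · intro r'' _ h
          simp [h]
        · simp
      · intro r'' _ h
        refine Finset.sum_eq_zero fun a _ => ?_
        simp [W, h]
      · simp
    have hpos := hX.conjTranspose_mul_mul_same W
    have hcalc : Wᴴ * X * W = (star w ⬝ᵥ w) • D χ := by
      rw [hXD, Matrix.mul_sum, Matrix.sum_mul, Finset.sum_eq_single χ]
      · rw [hcomp, hPw, if_pos rfl]
      · intro φ _ hφ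
        rw [hcomp, hPw, if_neg hφ, dotProduct_zero, zero_smul]
      · simp
    have hw0 : 0 < star w ⬝ᵥ w := dotProduct_star_self_pos_iff.mpr hv
    rw [hcalc] at hpos
    have := hpos.smul (a := (star w ⬝ᵥ w)⁻¹) (inv_nonneg.mpr hw0.le)
    rwa [smul_smul, inv_mul_cancel₀ hw0.ne', one_smul] at this
  have hfin : (1 : Matrix R R ℂ) ⊗ₖ traceFst X - X
      = ∑ χ, ((D χ).trace • (1 : Matrix R R ℂ) - D χ) ⊗ₖ isotypicProj G χ := by
    have h3 : traceFst X = ∑ χ, (D χ).trace • isotypicProj G χ := by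
      conv_lhs => rw [hXD]
      have : ∀ χ, (D χ).trace • isotypicProj G χ = traceFst (D χ ⊗ₖ isotypicProj G χ) :=
        fun χ => (traceFst_kronecker _ _).symm
      simp only [this]
      ext a b
      simp only [traceFst, of_apply, Matrix.sum_apply]
      rw [Finset.sum_comm]
    rw [h3]
    conv_lhs => rw [hXD]
    ext x y
    simp only [Matrix.sub_apply, kroneckerMap_apply, Matrix.sum_apply, Matrix.smul_apply, smul_eq_mul, Finset.mul_sum]
    rw [← Finset.sum_sub_distrib]
    refine Finset.sum_congr rfl fun χ _ => by ring
  rw [hfin]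
  refine posSemidef_sum _ fun χ _ => ?_
  by_cases hχ : isotypicProj G χ = 0
  · rw [hχ, kronecker_zero]
    exact PosSemidef.zero
  · exact (trace_smul_one_sub_posSemidef (hD χ hχ)).kronecker (hG.isotypicProj_posSemidef χ)

end Representation

section LogFormulas

open Matrix

variable {V R : Type*} [Fintype V] [DecidableEq V] [Fintype R] [DecidableEq R]

lemma cfc_smul_proj_add {P : Matrix V V ℂ} (hP : P.IsHermitian) (hPP : P * P = P) (a b : ℝ)
    (g : ℝ → ℝ) :
    cfc g ((a : ℂ) • P + (b : ℂ) • (1 : Matrix V V ℂ))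
      = (g (a + b) : ℂ) • P + (g b : ℂ) • (1 - P) := by
  obtain ⟨U, f, hU, rfl⟩ := exists_spectralForm hP
  have hU2 := mul_eq_one_comm.mp hU
  have hlin : ∀ p q : ℝ, (p : ℂ) • spectralForm U f + (q : ℂ) • (1 : Matrix V V ℂ)
      = spectralForm U (fun i => p * f i + q) := by
    intro p q
    have : diagonal (fun i => ((p * f i + q : ℝ) : ℂ))
        = (p : ℂ) • diagonal (fun i => (f i : ℂ)) + (q : ℂ) • (1 : Matrix V V ℂ) := by
      rw [smul_one_eq_diagonal, ← diagonal_smul, diagonal_add]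
      congr 1; ext i; push_cast; rfl
    rw [spectralForm, spectralForm, this, mul_add, add_mul, mul_smul_comm, smul_mul_assoc,
      mul_smul_comm, mul_one, smul_mul_assoc, hU2]
  have hf : ∀ i, f i = 0 ∨ f i = 1 := by
    have h1 : diagonal (fun i => (f i : ℂ)) * diagonal (fun i => (f i : ℂ))
        = diagonal (fun i => (f i : ℂ)) := by
      have h2 : Uᴴ * (spectralForm U f * spectralForm U f) * U = Uᴴ * spectralForm U f * U := by
        rw [hPP]
      calc _ = (Uᴴ * U) * diagonal (fun i => (f i : ℂ)) * (Uᴴ * U) *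
            diagonal (fun i => (f i : ℂ)) * (Uᴴ * U) := by
            rw [hU, one_mul, mul_one, mul_one]
        _ = Uᴴ * (spectralForm U f * spectralForm U f) * U := by
            unfold spectralForm; simp only [mul_assoc]
        _ = (Uᴴ * U) * diagonal (fun i => (f i : ℂ)) * (Uᴴ * U) := by
            rw [h2]; unfold spectralForm; simp only [mul_assoc]
        _ = _ := by rw [hU, one_mul, mul_one]
    intro i
    rw [diagonal_mul_diagonal] at h1
    have h3 := congr_fun (diagonal_injective h1) i
    have h4 : f i * f i = f i := by exact_mod_cast h3
    have h5 : f i * (f i - 1) = 0 := by linarith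
    rcases mul_eq_zero.mp h5 with h | h
    · exact Or.inl h
    · exact Or.inr (by linarith)
  rw [hlin, cfc_spectralForm hU]
  have h6 : (g (a + b) : ℂ) • spectralForm U f + (g b : ℂ) • (1 - spectralForm U f)
      = ((g (a + b) - g b : ℝ) : ℂ) • spectralForm U f + (g b : ℂ) • (1 : Matrix V V ℂ) := by
    push_cast
    module
  rw [h6, hlin]
  congr 1
  ext i
  rcases hf i with h | h <;> simp [h]

lemma log2_one_kronecker {Y : Matrix V V ℂ} (hY : Y.IsHermitian) :
    log2 ((1 : Matrix R R ℂ) ⊗ₖ Y) = (1 : Matrix R R ℂ) ⊗ₖ log2 Y := by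
  obtain ⟨U, f, hU, rfl⟩ := exists_spectralForm hY
  have h1 : ∀ g : V → ℝ, (1 : Matrix R R ℂ) ⊗ₖ spectralForm U g
      = spectralForm ((1 : Matrix R R ℂ) ⊗ₖ U) (fun x => g x.2) := by
    intro g
    have := kronecker_spectralForm (1 : Matrix R R ℂ) U (fun _ => 1) g
    simpa [spectralForm] using this
  have hU' : ((1 : Matrix R R ℂ) ⊗ₖ U)ᴴ * ((1 : Matrix R R ℂ) ⊗ₖ U) = 1 :=
    kronecker_isometry (by simp) hU
  rw [log2, log2, cfc_spectralForm hU, h1, h1, cfc_spectralForm hU']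
  rfl

omit [DecidableEq V] in
lemma trace_mul_one_kronecker (X : Matrix (R × V) (R × V) ℂ) (Y : Matrix V V ℂ) :
    (X * ((1 : Matrix R R ℂ) ⊗ₖ Y)).trace = (traceFst X * Y).trace := by
  simp only [trace, diag_apply, mul_apply, Fintype.sum_prod_type, kroneckerMap_apply, traceFst,
    of_apply, Finset.sum_mul]
  rw [Finset.sum_comm]
  refine Finset.sum_congr rfl fun a _ => ?_
  conv_rhs => rw [Finset.sum_comm]
  refine Finset.sum_congr rfl fun r _ => ?_
  rw [Finset.sum_eq_single r]
  · simp only [one_apply_eq, one_mul]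
  · intro r' _ h
    simp [one_apply_ne h]
  · simp

end LogFormulas

/-! ### Convolution by the beam splitter and Weyl operators -/

section Convolution

open Matrix

variable {d : ℕ} [Fact d.Prime]
variable {V R K : Type*} [AddCommGroup V] [Module (ZMod d) V] [Fintype V] [DecidableEq V]
  [Fintype R] [DecidableEq R] [AddCommGroup K] [Module (ZMod d) K] [Fintype K] [DecidableEq K]

/-- The convolution `Tr_B [U (X ⊗ Y) U†]` for the beam splitter `U : |i⟩|j⟩ ↦ |s i + t j⟩|s j - t i⟩`
on `ℂ^V ⊗ ℂ^V`, written in matrix entries. Here `V` is any finite vector space over `ℤ_d`. -/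
def conv (s t : ZMod d) (X Y : Matrix V V ℂ) : Matrix V V ℂ :=
  Matrix.of fun a a' => ∑ b, X (s • a - t • b) (s • a' - t • b) * Y (t • a + s • b) (t • a' + s • b)

/-- The Kraus operators of the channel `Y ↦ (I_R ⊗ Λ_Y)(|ψ⟩⟨ψ|)`, which acts on the environment
and prepares the joint output of the reference system and of the beam splitter. -/
def outputKraus (s t : ZMod d) (ψ : R × V → ℂ) (b : V) : Matrix (R × V) V ℂ :=
  Matrix.of fun x e => if e = t • x.2 + s • b then ψ (x.1, s • x.2 - t • b) else 0

omit [Fintype R] [DecidableEq R] in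
lemma krausMap_outputKraus_apply (s t : ZMod d) (ψ : R × V → ℂ) (Y : Matrix V V ℂ) (x y : R × V) :
    krausMap (outputKraus s t ψ) Y x y
      = conv s t (Matrix.of fun a a' => proj ψ (x.1, a) (y.1, a')) Y x.2 y.2 := by
  rw [krausMap, Matrix.sum_apply, conv, of_apply]
  refine Finset.sum_congr rfl fun b _ => ?_
  rw [mul_apply]
  simp only [mul_apply, outputKraus, conjTranspose_apply, of_apply, ite_mul, zero_mul,
    apply_ite star, star_zero, mul_ite, mul_zero, Finset.sum_ite_eq', Finset.mem_univ, if_true,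
    proj, vecMulVec_apply, Pi.star_apply]
  ring

omit [DecidableEq R] in
lemma sum_outputKraus {s t : ZMod d} (hst : s ^ 2 + t ^ 2 = 1) {ψ : R × V → ℂ}
    (hψ : ∑ x, ‖ψ x‖ ^ 2 = 1) :
    ∑ b, (outputKraus s t ψ b)ᴴ * outputKraus s t ψ b = 1 := by
  ext e e'
  simp only [Matrix.sum_apply, mul_apply, Fintype.sum_prod_type, outputKraus, conjTranspose_apply,
    of_apply]
  by_cases he : e = e'
  · subst he
    rw [one_apply_eq]
    have h1 : ∀ (b : V) (r : R) (a : V),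
        star (if e = t • a + s • b then ψ (r, s • a - t • b) else 0) *
          (if e = t • a + s • b then ψ (r, s • a - t • b) else 0)
        = if e = t • a + s • b then ((‖ψ (r, s • a - t • b)‖ ^ 2 : ℝ) : ℂ) else 0 := by
      intro b r a
      split_ifs
      · rw [mul_comm, Complex.star_def, Complex.mul_conj']; push_cast; rfl
      · simp
    simp only [h1]
    rw [Finset.sum_comm]
    have h2 : ∀ r : R, ∑ b : V, ∑ a : V,
        (if e = t • a + s • b then ((‖ψ (r, s • a - t • b)‖ ^ 2 : ℝ) : ℂ) else 0)
        = ∑ u : V, ((‖ψ (r, u)‖ ^ 2 : ℝ) : ℂ) := by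
      intro r
      rw [← Fintype.sum_prod_type', ← Finset.sum_filter]
      refine Finset.sum_bij' (fun x _ => s • x.2 - t • x.1) (fun u _ => (s • e - t • u, t • e + s • u))
        ?_ ?_ ?_ ?_ ?_
      · simp
      · intro u _
        simp only [Finset.mem_filter, Finset.mem_univ, true_and]
        have : e = (s ^ 2 + t ^ 2) • e := by rw [hst, one_smul]
        conv_lhs => rw [this]
        module
      · rintro ⟨b, a⟩ h
        simp only [Finset.mem_filter, Finset.mem_univ, true_and] at h
        subst h
        have h3 : s • (t • a + s • b) - t • (s • a - t • b) = (s ^ 2 + t ^ 2) • b := by module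
        have h4 : t • (t • a + s • b) + s • (s • a - t • b) = (s ^ 2 + t ^ 2) • a := by module
        simp only [h3, h4, hst, one_smul]
      · intro u _
        have h3 : s • (t • e + s • u) - t • (s • e - t • u) = (s ^ 2 + t ^ 2) • u := by module
        simp only [h3, hst, one_smul]
      · simp
    simp only [h2]
    rw [← Complex.ofReal_one, ← hψ, Fintype.sum_prod_type]
    push_cast
    rfl
  · rw [one_apply_ne he]
    refine Finset.sum_eq_zero fun b _ => Finset.sum_eq_zero fun r _ =>
      Finset.sum_eq_zero fun a _ => ?_
    by_cases h : e = t • a + s • b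
    · rw [if_neg (c := e' = _) (fun h' => he (h.trans h'.symm)), mul_zero]
    · rw [if_neg h, star_zero, zero_mul]

omit [DecidableEq R] in
lemma traceFst_krausMap_outputKraus (s t : ZMod d) (ψ : R × V → ℂ) (Y : Matrix V V ℂ) :
    traceFst (krausMap (outputKraus s t ψ) Y) = conv s t (traceFst (proj ψ)) Y := by
  ext a a'
  simp only [traceFst, of_apply, krausMap_outputKraus_apply, conv, Finset.sum_mul]
  rw [Finset.sum_comm]

/-- The Weyl operator `|b⟩ ↦ ω^{c + ℓ(b + q)} |b + q⟩` on `ℂ^V`: translation by `q`, followed by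
multiplication with the character `ω^ℓ` and with the phase `ω^c`. -/
def phaseShift (c : ZMod d) (l : Module.Dual (ZMod d) V) (q : V) : Matrix V V ℂ :=
  Matrix.of fun a b => if a = b + q then omega (c + l a) else 0

lemma omega_add (a b : ZMod d) : omega (a + b) = omega a * omega b :=
  AddChar.map_add_eq_mul _ _ _

lemma omega_zero : omega (0 : ZMod d) = 1 := AddChar.map_zero_eq_one _

lemma omega_sum {ι : Type*} (S : Finset ι) (f : ι → ZMod d) :
    omega (∑ i ∈ S, f i) = ∏ i ∈ S, omega (f i) := by
  classical
  induction S using Finset.induction_on with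
  | empty => exact omega_zero
  | insert i S hi ih => rw [Finset.sum_insert hi, Finset.prod_insert hi, omega_add, ih]

lemma star_omega (a : ZMod d) : star (omega a) = omega (-a) :=
  (AddChar.map_neg_eq_conj _ _).symm

lemma phaseShift_mul (c c' : ZMod d) (l l' : Module.Dual (ZMod d) V) (q q' : V) :
    phaseShift c l q * phaseShift c' l' q' = phaseShift (c + c' - l' q) (l + l') (q + q') := by
  ext a b
  rw [mul_apply, Finset.sum_eq_single (b + q')]
  · simp only [phaseShift, of_apply, if_true]
    by_cases h : a = b + q' + q
    · have h' : a = b + (q + q') := by rw [h]; abel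
      rw [if_pos h, if_pos h', ← omega_add]
      congr 1
      subst h
      simp only [_root_.map_add, LinearMap.add_apply]
      ring
    · have h' : ¬ a = b + (q + q') := fun h' => h (by rw [h']; abel)
      rw [if_neg h, if_neg h', zero_mul]
  · intro x _ hx
    simp [phaseShift, hx]
  · simp

lemma phaseShift_unitary (c : ZMod d) (l : Module.Dual (ZMod d) V) (q : V) :
    (phaseShift c l q)ᴴ * phaseShift c l q = 1 := by
  ext a b
  rw [mul_apply, Finset.sum_eq_single (b + q)]
  · simp only [phaseShift, conjTranspose_apply, of_apply, if_true]
    by_cases h : a = b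
    · subst h
      rw [if_pos rfl, star_omega, ← omega_add, neg_add_cancel, omega_zero, one_apply_eq]
    · rw [if_neg (fun h' => h (add_right_cancel h').symm), star_zero, zero_mul, one_apply_ne h]
  · intro x _ hx
    simp [phaseShift, hx]
  · simp

/-- The convolution with a Weyl operator measures the input and returns a multiple of the Weyl
operator at the rescaled phase space point. -/
lemma exists_conv_phaseShift {s t : ZMod d} (hst : s ^ 2 + t ^ 2 = 1) (ht : t ≠ 0)
    (c c' : ZMod d) (l : Module.Dual (ZMod d) V) (q : V) (X : Matrix V V ℂ) :
    ∃ β : ℂ, conv s t X (phaseShift c l q) = β • phaseShift c' (t⁻¹ • l) (t⁻¹ • q) := by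
  refine ⟨omega (c - c') * ∑ u, X u (u - (s * t⁻¹) • q) * omega (-(s * t⁻¹ * l u)), ?_⟩
  ext a a'
  rw [conv, of_apply, Matrix.smul_apply, smul_eq_mul]
  simp only [phaseShift, of_apply]
  have hcond : ∀ b : V, (t • a + s • b = t • a' + s • b + q) ↔ a = a' + t⁻¹ • q := by
    intro b
    have e : t • (a' + t⁻¹ • q) = t • a' + q := by rw [smul_add, smul_inv_smul₀ ht]
    constructor
    · intro h
      have h' : t • a = t • (a' + t⁻¹ • q) := by
        rw [e]
        have : t • a + s • b = (t • a' + q) + s • b := by rw [h]; abel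
        exact add_right_cancel this
      exact smul_right_injective V ht h'
    · intro h
      rw [h, e]; abel
  simp only [hcond]
  by_cases h : a = a' + t⁻¹ • q
  · simp only [if_pos h]
    rw [mul_assoc, Finset.sum_mul, Finset.mul_sum]
    -- substitute `u = s a - t b`
    let φ : V ≃ V :=
      { toFun := fun b => s • a - t • b
        invFun := fun u => t⁻¹ • (s • a - u)
        left_inv := fun b => by
          simp only [sub_sub_cancel, inv_smul_smul₀ ht]
        right_inv := fun u => by
          simp only [smul_inv_smul₀ ht, sub_sub_cancel] }
    conv_rhs => rw [← Equiv.sum_comp φ]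
    refine Finset.sum_congr rfl fun b _ => ?_
    have h1 : s • a' - t • b = φ b - (s * t⁻¹) • q := by
      simp only [φ, Equiv.coe_fn_mk, h, mul_smul, smul_add]
      abel
    have h2 : c + l (t • a + s • b) = (c - c') + (-(s * t⁻¹ * l (φ b))
        + (c' + (t⁻¹ • l) a)) := by
      simp only [φ, Equiv.coe_fn_mk, map_sub, _root_.map_add, map_smul, smul_eq_mul,
        LinearMap.smul_apply]
      have e1 : t⁻¹ * t = 1 := inv_mul_cancel₀ ht
      have e2 : t⁻¹ * (s ^ 2 + t ^ 2) = t⁻¹ := by rw [hst, mul_one]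
      have e3 : t⁻¹ * s ^ 2 + t = t⁻¹ := by linear_combination e2 - t * e1
      linear_combination (-s * l b) * e1 + l a * e3
    rw [h1, h2, omega_add, omega_add]
    change X (φ b) _ * _ = _
    ring
  · simp [if_neg h]

/-- A unitary representation of the vector space `K` over `ℤ_d` by Weyl operators on `ℂ^V`, whose
phase space points depend linearly on `K`: a parametrized stabilizer group. -/
structure IsWeylRep (G : K → Matrix V V ℂ) : Prop extends IsUnitaryRep G where
  exists_form : ∃ (c : K → ZMod d) (l : K →ₗ[ZMod d] Module.Dual (ZMod d) V)
    (q : K →ₗ[ZMod d] V), ∀ k, G k = phaseShift (c k) (l k) (q k)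

end Convolution

/-! ### The coherent information with a stabilized environment -/

section CoherentInformation

open Matrix

variable {d : ℕ} [Fact d.Prime]
variable {V R K : Type*} [AddCommGroup V] [Module (ZMod d) V] [Fintype V] [DecidableEq V]
  [Fintype R] [DecidableEq R] [AddCommGroup K] [Module (ZMod d) K] [Fintype K] [DecidableEq K]

omit [DecidableEq V] in
lemma conv_smul_right (s t : ZMod d) (X Y : Matrix V V ℂ) (a : ℂ) :
    conv s t X (a • Y) = a • conv s t X Y := by
  ext i j
  simp only [conv, of_apply, Matrix.smul_apply, smul_eq_mul, Finset.mul_sum]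
  refine Finset.sum_congr rfl fun b _ => by ring

omit [DecidableEq V] in
lemma conv_add_right (s t : ZMod d) (X Y Z : Matrix V V ℂ) :
    conv s t X (Y + Z) = conv s t X Y + conv s t X Z := by
  ext i j
  simp only [conv, of_apply, Matrix.add_apply, mul_add, Finset.sum_add_distrib]

omit [Fintype K] [DecidableEq K] in
lemma conv_mem_span {G : K → Matrix V V ℂ} (hG : IsWeylRep (d := d) G) {s t : ZMod d}
    (hst : s ^ 2 + t ^ 2 = 1) (ht : t ≠ 0) (X : Matrix V V ℂ) {Y : Matrix V V ℂ}
    (hY : Y ∈ Submodule.span ℂ (Set.range G)) :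
    conv s t X Y ∈ Submodule.span ℂ (Set.range G) := by
  induction hY using Submodule.span_induction with
  | mem y hy =>
    obtain ⟨k, rfl⟩ := hy
    obtain ⟨c, l, q, h⟩ := hG.exists_form
    obtain ⟨β, hβ⟩ := exists_conv_phaseShift hst ht (c k) (c (t⁻¹ • k)) (l k) (q k) X
    rw [h, hβ, ← map_smul, ← map_smul, ← h]
    exact Submodule.smul_mem _ _ (Submodule.subset_span ⟨_, rfl⟩)
  | zero =>
    have : conv s t X 0 = 0 := by simpa using conv_smul_right s t X 0 0
    rw [this]
    exact Submodule.zero_mem _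
  | add y z _ _ hy hz => rw [conv_add_right]; exact Submodule.add_mem _ hy hz
  | smul a y _ hy => rw [conv_smul_right]; exact Submodule.smul_mem _ _ hy

/-- The average of a representation, i.e. the projection onto its invariant vectors. -/
def invariantProj (G : K → Matrix V V ℂ) : Matrix V V ℂ :=
  (Fintype.card K : ℂ)⁻¹ • ∑ k, G k

omit [AddCommGroup V] [Fintype V] [DecidableEq V] [DecidableEq K] in
lemma invariantProj_eq_isotypicProj (G : K → Matrix V V ℂ) :
    invariantProj G = isotypicProj G 0 := by
  simp [invariantProj, isotypicProj]

omit [AddCommGroup V] [DecidableEq V] [DecidableEq R] in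
lemma trace_traceFst (X : Matrix (R × V) (R × V) ℂ) : (traceFst X).trace = X.trace := by
  simp only [trace, diag_apply, traceFst, of_apply, Fintype.sum_prod_type]
  rw [Finset.sum_comm]

omit [AddCommGroup V] [Fintype V] [DecidableEq V] [DecidableEq R] in
lemma traceFst_posSemidef {X : Matrix (R × V) (R × V) ℂ} (hX : X.PosSemidef) :
    (traceFst X).PosSemidef := by
  have : traceFst X = ∑ r : R, X.submatrix (fun a => (r, a)) (fun a => (r, a)) := by
    ext a b
    simp [traceFst, Matrix.sum_apply]
  rw [this]
  exact posSemidef_sum _ fun r _ => hX.submatrix _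

/-- The coherent information of the beam splitter with environment `Y` supported in the code space
of a stabilizer group is at most `log D - S(Y)`, where `D` is the dimension of the code space.
The bound is `D(Y‖P/D)`, for the projection `P` onto the code space. -/
theorem entropy_sub_entropy_le {G : K → Matrix V V ℂ} (hG : IsWeylRep (d := d) G) {s t : ZMod d}
    (hst : s ^ 2 + t ^ 2 = 1) (ht : t ≠ 0) {Y : Matrix V V ℂ} (hY : IsState Y) {D : ℝ}
    (hD : 0 < D) (htr : (invariantProj G).trace = (D : ℂ)) (hPY : Y * invariantProj G = Y)
    {ψ : R × V → ℂ} (hψ : ∑ x, ‖ψ x‖ ^ 2 = 1) :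
    entropy (traceFst (krausMap (outputKraus s t ψ) Y)) - entropy (krausMap (outputKraus s t ψ) Y)
      ≤ Real.logb 2 D - entropy Y := by
  have hK := sum_outputKraus hst hψ
  set N := krausMap (outputKraus s t ψ) with hN
  set P := invariantProj G with hPdef
  have hP : P.PosSemidef := by
    rw [hPdef, invariantProj_eq_isotypicProj]; exact hG.isotypicProj_posSemidef 0
  have hPP : P * P = P := by
    rw [hPdef, invariantProj_eq_isotypicProj, hG.isotypicProj_mul, if_pos rfl]
  have hNY : (N Y).PosSemidef := krausMap_posSemidef _ hY.1
  have hNYtr : (N Y).trace = 1 := by rw [hN, trace_krausMap hK, hY.2]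
  have hlog2 : (0 : ℝ) < Real.log 2 := Real.log_pos one_lt_two
  -- the inequality with the full-rank reference operator `P/D + ε`, up to an error of order `ε`
  have key : ∀ ε : ℝ, 0 < ε →
      entropy (traceFst (N Y)) - entropy (N Y)
        ≤ (-Real.logb 2 (D⁻¹ + ε) - entropy Y) + 2 * (ε * Fintype.card V) / Real.log 2 := by
    intro ε hε
    set T : Matrix V V ℂ := ((D⁻¹ : ℝ) : ℂ) • P + ((ε : ℝ) : ℂ) • (1 : Matrix V V ℂ) with hT
    have hε1 : (((ε : ℝ) : ℂ) • (1 : Matrix V V ℂ)).PosDef :=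
      PosDef.one.smul (by exact_mod_cast hε)
    have hTpos : T.PosDef := by
      refine PosDef.posSemidef_add (hP.smul ?_) hε1
      exact_mod_cast inv_nonneg.mpr hD.le
    have hTspan : T ∈ Submodule.span ℂ (Set.range G) := by
      refine Submodule.add_mem _ (Submodule.smul_mem _ _ (Submodule.smul_mem _ _
        (Submodule.sum_mem _ fun k _ => Submodule.subset_span ⟨k, rfl⟩))) ?_
      rw [← hG.map_zero]
      exact Submodule.smul_mem _ _ (Submodule.subset_span ⟨0, rfl⟩)
    have hTtr : T.trace = ((1 + ε * Fintype.card V : ℝ) : ℂ) := by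
      have hD' : (D : ℂ) ≠ 0 := by exact_mod_cast hD.ne'
      rw [hT, trace_add, trace_smul, trace_smul, htr, trace_one, smul_eq_mul, smul_eq_mul]
      push_cast
      rw [inv_mul_cancel₀ hD']
    have hNT : (N T).PosSemidef := krausMap_posSemidef _ hTpos.posSemidef
    have hsep : ((1 : Matrix R R ℂ) ⊗ₖ traceFst (N T) - N T).PosSemidef := by
      refine one_kronecker_traceFst_sub_posSemidef hG.toIsUnitaryRep hNT fun r r' => ?_
      have : (Matrix.of fun a a' => N T (r, a) (r', a'))
          = conv s t (Matrix.of fun a a' => proj ψ (r, a) (r', a')) T := by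
        ext a a'
        rw [of_apply, hN, krausMap_outputKraus_apply]
      rw [this]
      exact conv_mem_span hG hst ht _ hTspan
    set ω : Matrix V V ℂ := traceFst (N T) + ((ε : ℝ) : ℂ) • (1 : Matrix V V ℂ) with hω
    have hωpos : ω.PosDef := PosDef.posSemidef_add (traceFst_posSemidef hNT) hε1
    have hωtr : ω.trace = ((1 + 2 * (ε * Fintype.card V) : ℝ) : ℂ) := by
      rw [hω, trace_add, trace_traceFst, hN, trace_krausMap hK, hTtr, trace_smul, trace_one,
        smul_eq_mul]
      push_cast
      ring
    have hdom : ((1 : Matrix R R ℂ) ⊗ₖ ω - N T).PosSemidef := by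
      have : (1 : Matrix R R ℂ) ⊗ₖ ω - N T
          = ((1 : Matrix R R ℂ) ⊗ₖ traceFst (N T) - N T)
            + (1 : Matrix R R ℂ) ⊗ₖ (((ε : ℝ) : ℂ) • (1 : Matrix V V ℂ)) := by
        rw [hω, kronecker_add]; abel
      rw [this]
      exact hsep.add (PosSemidef.one.kronecker hε1.posSemidef)
    have hdpi := relEntropy_krausMap_le hK hY.1 hTpos (PosDef.one.kronecker hωpos) hdom
    rw [← hN, log2_one_kronecker hωpos.isHermitian, trace_mul_one_kronecker] at hdpi
    have hklein := klein_inequality (traceFst_posSemidef hNY) hωpos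
    rw [trace_traceFst, hNYtr, hωtr, Complex.ofReal_re, Complex.one_re] at hklein
    have hlogT : (Y * log2 T).trace = (Real.logb 2 (D⁻¹ + ε) : ℂ) := by
      rw [log2, hT, cfc_smul_proj_add hP.isHermitian hPP, mul_add, mul_smul_comm, hPY,
        mul_smul_comm, mul_sub, mul_one, hPY, sub_self, smul_zero, add_zero, trace_smul, hY.2,
        smul_eq_mul, mul_one]
    rw [hlogT] at hdpi
    simp only [Complex.sub_re, Complex.ofReal_re] at hdpi hklein
    have e : (1 - (1 + 2 * (ε * (Fintype.card V : ℝ)))) / Real.log 2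
        = -(2 * (ε * Fintype.card V) / Real.log 2) := by ring
    rw [e] at hklein
    unfold entropy
    linarith
  have hlim : Filter.Tendsto (fun ε : ℝ => (-Real.logb 2 (D⁻¹ + ε) - entropy Y)
      + 2 * (ε * Fintype.card V) / Real.log 2) (nhdsWithin 0 (Set.Ioi 0))
      (nhds (Real.logb 2 D - entropy Y)) := by
    have hc : ContinuousAt (fun ε : ℝ => (-Real.logb 2 (D⁻¹ + ε) - entropy Y)
        + 2 * (ε * Fintype.card V) / Real.log 2) 0 := by
      have h0 : D⁻¹ + 0 ≠ 0 := by rw [add_zero]; exact (inv_pos.mpr hD).ne'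
      have h1 : ContinuousAt (fun ε : ℝ => Real.logb 2 (D⁻¹ + ε)) 0 := by
        unfold Real.logb
        exact ((continuousAt_const.add continuousAt_id).log h0).div_const _
      fun_prop
    have h2 : Real.logb 2 D - entropy Y = (-Real.logb 2 (D⁻¹ + 0) - entropy Y)
        + 2 * (0 * (Fintype.card V : ℝ)) / Real.log 2 := by
      rw [add_zero, Real.logb_inv]; ring
    rw [h2]
    exact hc.tendsto.mono_left nhdsWithin_le_nhds
  exact ge_of_tendsto hlim (Filter.eventually_of_mem self_mem_nhdsWithin key)

end CoherentInformation

/-! ### Tensor powers -/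

section TensorPowers

open Matrix

variable {A K : Type*} [Fintype A] [DecidableEq A] [Fintype K] [DecidableEq K] {N : ℕ}

/-- The tensor product `X₁ ⊗ ⋯ ⊗ X_N`. -/
def tensorProd (X : Fin N → Matrix A A ℂ) : Matrix (Fin N → A) (Fin N → A) ℂ :=
  Matrix.of fun a b => ∏ i, X i (a i) (b i)

omit [DecidableEq A] in
lemma tensorProd_mul (X Y : Fin N → Matrix A A ℂ) :
    tensorProd X * tensorProd Y = tensorProd fun i => X i * Y i := by
  ext a b
  simp only [tensorProd, mul_apply, of_apply, Finset.prod_univ_sum, Fintype.piFinset_univ,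
    Finset.prod_mul_distrib]

omit [Fintype A] [DecidableEq A] in
lemma tensorProd_conjTranspose (X : Fin N → Matrix A A ℂ) :
    (tensorProd X)ᴴ = tensorProd fun i => (X i)ᴴ := by
  ext a b
  simp only [tensorProd, conjTranspose_apply, of_apply, star_prod]

omit [Fintype A] in
lemma tensorProd_one : tensorProd (fun _ : Fin N => (1 : Matrix A A ℂ)) = 1 := by
  ext a b
  simp only [tensorProd, of_apply, Matrix.one_apply, Finset.prod_ite_zero, Finset.prod_const_one,
    Finset.mem_univ, true_implies, funext_iff]

omit [DecidableEq A] in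
lemma trace_tensorProd (X : Fin N → Matrix A A ℂ) :
    (tensorProd X).trace = ∏ i, (X i).trace := by
  simp only [trace, diag_apply, tensorProd, of_apply, Finset.prod_univ_sum, Fintype.piFinset_univ]

omit [Fintype A] [DecidableEq A] [DecidableEq K] in
lemma sum_tensorProd (G : K → Matrix A A ℂ) :
    ∑ k : Fin N → K, tensorProd (fun i => G (k i)) = tensorProd fun _ => ∑ k, G k := by
  ext a b
  simp only [tensorProd, Matrix.sum_apply, of_apply, Finset.prod_univ_sum, Fintype.piFinset_univ]

/-- The tensor power `X ⊗ ⋯ ⊗ X`. -/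
def tensorPow (X : Matrix A A ℂ) (N : ℕ) : Matrix (Fin N → A) (Fin N → A) ℂ :=
  tensorProd fun _ => X

lemma tensorPow_isState {X : Matrix A A ℂ} (hX : IsState X) (N : ℕ) :
    IsState (tensorPow X N) := by
  refine ⟨?_, by simp [tensorPow, trace_tensorProd, hX.2]⟩
  obtain ⟨U, f, hU, rfl⟩ := exists_spectralForm hX.1.isHermitian
  have hf := spectralForm_nonneg hU hX.1
  have h : tensorPow (spectralForm U f) N
      = tensorPow U N * diagonal (fun a : Fin N → A => ((∏ i, f (a i) : ℝ) : ℂ))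
        * (tensorPow U N)ᴴ := by
    have : diagonal (fun a : Fin N → A => ((∏ i, f (a i) : ℝ) : ℂ))
        = tensorPow (diagonal fun i => (f i : ℂ)) N := by
      ext a b
      simp only [tensorPow, tensorProd, of_apply, diagonal_apply, Finset.prod_ite_zero,
        Finset.mem_univ, true_implies, funext_iff]
      push_cast
      rfl
    rw [this, tensorPow, tensorPow, tensorPow, tensorProd_conjTranspose, tensorProd_mul,
      tensorProd_mul]
    rfl
  rw [h]
  refine PosSemidef.mul_mul_conjTranspose_same (posSemidef_diagonal_iff.mpr fun a => ?_) _
  exact_mod_cast Finset.prod_nonneg fun i _ => hf (a i)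

omit [Fintype A] [DecidableEq A] in
lemma tensorPow_add (X : Matrix A A ℂ) (M N : ℕ) :
    tensorPow X (M + N) = (tensorPow X M ⊗ₖ tensorPow X N).submatrix
      (Fin.appendEquiv M N).symm (Fin.appendEquiv M N).symm := by
  ext a b
  simp only [tensorPow, tensorProd, of_apply, Fin.prod_univ_add, submatrix_apply,
    kroneckerMap_apply]
  rfl

lemma entropy_tensorPow {X : Matrix A A ℂ} (hX : IsState X) (N : ℕ) :
    entropy (tensorPow X N) = N * entropy X := by
  induction N with
  | zero =>
    have h : tensorPow X 0 = spectralForm 1 (fun _ => 1) := by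
      ext a b
      simp [tensorPow, tensorProd, spectralForm, Subsingleton.elim a b]
    rw [h, entropy_spectralForm (by simp)]
    simp
  | succ N ih =>
    have h1 : tensorPow X 1 = X.submatrix (Equiv.funUnique (Fin 1) A)
        (Equiv.funUnique (Fin 1) A) := by
      ext a b
      simp [tensorPow, tensorProd]
    have hN := tensorPow_isState hX N
    have h1s := tensorPow_isState hX 1
    rw [tensorPow_add, entropy_submatrix _ (hN.1.kronecker h1s.1).isHermitian,
      entropy_kronecker hN.1.isHermitian h1s.1.isHermitian hN.2 h1s.2, ih, h1,
      entropy_submatrix _ hX.1.isHermitian]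
    push_cast
    ring

end TensorPowers

section TensorRep

open Matrix

variable {d : ℕ} [Fact d.Prime]
variable {V K : Type*} [AddCommGroup V] [Module (ZMod d) V] [Fintype V] [DecidableEq V]
  [AddCommGroup K] [Module (ZMod d) K] [Fintype K] [DecidableEq K]

omit [Fintype V] in
lemma tensorProd_phaseShift {N : ℕ} (c : Fin N → ZMod d) (l : Fin N → Module.Dual (ZMod d) V)
    (q : Fin N → V) :
    tensorProd (fun i => phaseShift (c i) (l i) (q i))
      = phaseShift (∑ i, c i) (∑ i, (l i) ∘ₗ LinearMap.proj i) q := by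
  ext a b
  simp only [tensorProd, phaseShift, of_apply, Finset.prod_ite_zero, Finset.mem_univ,
    true_implies, LinearMap.sum_apply, LinearMap.comp_apply, LinearMap.proj_apply,
    ← Finset.sum_add_distrib]
  simp only [omega_sum, funext_iff, Pi.add_apply]

omit [Fintype K] [DecidableEq K] in
lemma IsWeylRep.tensorPow {G : K → Matrix V V ℂ} (hG : IsWeylRep (d := d) G) (N : ℕ) :
    IsWeylRep (d := d) fun k : Fin N → K => tensorProd fun i => G (k i) where
  map_add k l := by
    rw [tensorProd_mul]
    simp only [Pi.add_apply, hG.map_add]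
  unitary k := by
    rw [tensorProd_conjTranspose, tensorProd_mul]
    simp only [hG.unitary, tensorProd_one]
  exists_form := by
    obtain ⟨c, l, q, h⟩ := hG.exists_form
    refine ⟨fun k => ∑ i, c (k i),
      { toFun := fun k => ∑ i, (l (k i)) ∘ₗ LinearMap.proj i
        map_add' := fun k k' => by
          simp only [Pi.add_apply, _root_.map_add, LinearMap.add_comp, Finset.sum_add_distrib]
        map_smul' := fun a k => by
          simp only [Pi.smul_apply, map_smul, LinearMap.smul_comp, Finset.smul_sum,
            RingHom.id_apply] },
      LinearMap.pi fun i => q ∘ₗ LinearMap.proj i, fun k => ?_⟩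
    simp only [h]
    exact tensorProd_phaseShift _ _ _

omit [AddCommGroup V] [AddCommGroup K] [Fintype V] [DecidableEq V] [DecidableEq K] in
lemma invariantProj_tensorPow (G : K → Matrix V V ℂ) (N : ℕ) :
    invariantProj (fun k : Fin N → K => tensorProd fun i => G (k i))
      = tensorPow (invariantProj G) N := by
  rw [invariantProj, sum_tensorProd]
  ext a b
  simp only [tensorPow, tensorProd, invariantProj, of_apply, Matrix.smul_apply, smul_eq_mul,
    Finset.prod_mul_distrib, Finset.prod_const, Finset.card_univ, Fintype.card_fin,
    Fintype.card_pi, Nat.cast_pow, inv_pow]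

end TensorRep

/-! ### Independent uses of the channel and the regularized coherent information -/

section Channel

open Matrix

variable {d n : ℕ} [Fact d.Prime]

lemma beamSplitter_apply {s t : ZMod d} (hst : s ^ 2 + t ^ 2 = 1)
    (x y : (Fin n → ZMod d) × (Fin n → ZMod d)) :
    beamSplitter n s t x y
      = if y = (s • x.1 - t • x.2, t • x.1 + s • x.2) then 1 else 0 := by
  obtain ⟨a, b⟩ := x
  obtain ⟨i, j⟩ := y
  have h1 : beamSplitter n s t (a, b) (i, j)
      = if s • i + t • j = a ∧ -t • i + s • j = b then 1 else 0 := by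
    rw [beamSplitter, Matrix.sum_apply, Finset.sum_eq_single i]
    · rw [Matrix.sum_apply, Finset.sum_eq_single j]
      · simp only [kroneckerMap_apply, single_apply, and_true]
        split_ifs <;> simp_all
      · intro j' _ h
        simp [single_apply, h]
      · simp
    · intro i' _ h
      rw [Matrix.sum_apply]
      refine Finset.sum_eq_zero fun j' _ => ?_
      simp [single_apply, h]
    · simp
  rw [h1]
  congr 1
  rw [Prod.mk.injEq]
  refine propext ⟨?_, ?_⟩
  · rintro ⟨rfl, rfl⟩
    have h3 : s • (s • i + t • j) - t • (-t • i + s • j) = (s ^ 2 + t ^ 2) • i := by module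
    have h4 : t • (s • i + t • j) + s • (-t • i + s • j) = (s ^ 2 + t ^ 2) • j := by module
    simp only [h3, h4, hst, one_smul, and_self]
  · rintro ⟨rfl, rfl⟩
    have h3 : s • (s • a - t • b) + t • (t • a + s • b) = (s ^ 2 + t ^ 2) • a := by module
    have h4 : -t • (s • a - t • b) + s • (t • a + s • b) = (s ^ 2 + t ^ 2) • b := by module
    simp only [h3, h4, hst, one_smul, and_self]

lemma beamSplitterChannel_apply {s t : ZMod d} (hst : s ^ 2 + t ^ 2 = 1)
    (σ ρ : Matrix (Fin n → ZMod d) (Fin n → ZMod d) ℂ) :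
    beamSplitterChannel s t σ ρ = conv s t ρ σ := by
  ext a a'
  change traceSnd (beamSplitter n s t * (ρ ⊗ₖ σ) * (beamSplitter n s t)ᴴ) a a' = _
  rw [traceSnd, of_apply, conv, of_apply]
  refine Finset.sum_congr rfl fun b _ => ?_
  simp only [mul_apply, conjTranspose_apply, beamSplitter_apply hst, ite_mul, one_mul, zero_mul,
    apply_ite star, star_one, star_zero, mul_ite, mul_one, mul_zero, Finset.sum_ite_eq',
    Finset.mem_univ, if_true, kroneckerMap_apply]

lemma tensorPower_beamSplitterChannel {s t : ZMod d} (hst : s ^ 2 + t ^ 2 = 1)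
    (σ : Matrix (Fin n → ZMod d) (Fin n → ZMod d) ℂ) (N : ℕ)
    (X : Matrix (Fin N → Fin n → ZMod d) (Fin N → Fin n → ZMod d) ℂ) :
    tensorPower (beamSplitterChannel s t σ) N X = conv s t X (tensorPow σ N) := by
  ext a a'
  change ∑ b, ∑ b', X b b' *
    ∏ i, beamSplitterChannel s t σ (Matrix.single (b i) (b' i) 1) (a i) (a' i) = _
  have h : ∀ b b' : Fin N → Fin n → ZMod d,
      ∏ i, beamSplitterChannel s t σ (Matrix.single (b i) (b' i) 1) (a i) (a' i)
      = ∑ c : Fin N → Fin n → ZMod d, if b = s • a - t • c ∧ b' = s • a' - t • c then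
        tensorPow σ N (t • a + s • c) (t • a' + s • c) else 0 := by
    intro b b'
    simp only [beamSplitterChannel_apply hst, conv, of_apply, Finset.prod_univ_sum,
      Fintype.piFinset_univ]
    refine Finset.sum_congr rfl fun c _ => ?_
    simp only [single_apply, ite_mul, one_mul, zero_mul, Finset.prod_ite_zero, Finset.mem_univ,
      true_implies, forall_and, funext_iff]
    rfl
  simp only [h, Finset.mul_sum]
  rw [conv, of_apply]
  simp only [ite_and, mul_ite, mul_zero]
  calc _ = ∑ b, ∑ c : Fin N → Fin n → ZMod d, ∑ b', (if b = s • a - t • c then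
        if b' = s • a' - t • c then X b b' * tensorPow σ N (t • a + s • c) (t • a' + s • c)
        else 0 else 0) := Finset.sum_congr rfl fun b _ => Finset.sum_comm
    _ = ∑ c : Fin N → Fin n → ZMod d, ∑ b, ∑ b', (if b = s • a - t • c then
        if b' = s • a' - t • c then X b b' * tensorPow σ N (t • a + s • c) (t • a' + s • c)
        else 0 else 0) := Finset.sum_comm
    _ = _ := by
      refine Finset.sum_congr rfl fun c _ => ?_
      rw [Finset.sum_eq_single (s • a - t • c)]
      · simp
      · intro b _ hb
        simp [hb]
      · simp

end Channel

section Capacity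

open Matrix

variable {d : ℕ} [Fact d.Prime]
variable {V R : Type*} [AddCommGroup V] [Module (ZMod d) V] [Fintype V] [DecidableEq V]
  [Fintype R] [DecidableEq R]

/-- The coherent information of the beam splitter with environment `Y` on the state purified by
`ψ`. -/
def beamSplitterInfo (s t : ZMod d) (Y : Matrix V V ℂ) (ψ : R × V → ℂ) : ℝ :=
  entropy (traceFst (krausMap (outputKraus s t ψ) Y)) - entropy (krausMap (outputKraus s t ψ) Y)

lemma trace_proj {A : Type*} [Fintype A] (ψ : A → ℂ) :
    (proj ψ).trace = ((∑ x, ‖ψ x‖ ^ 2 : ℝ) : ℂ) := by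
  simp only [trace, diag_apply, proj, vecMulVec_apply, Pi.star_apply, Complex.star_def,
    Complex.mul_conj']
  push_cast
  rfl

lemma proj_posSemidef {A : Type*} [Fintype A] (ψ : A → ℂ) : (proj ψ).PosSemidef :=
  posSemidef_vecMulVec_self_star ψ

lemma coherentInfo_eq_beamSplitterInfo {s t : ZMod d} {Y : Matrix V V ℂ}
    {Λ : Matrix V V ℂ →ₗ[ℂ] Matrix V V ℂ} (hΛ : ∀ X, Λ X = conv s t X Y) {ρ : Matrix V V ℂ}
    {ψ : R × V → ℂ} (hψ : IsPurification ψ ρ) :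
    coherentInfo Λ ρ ψ = beamSplitterInfo s t Y ψ := by
  have h1 : idTensor R Λ (proj ψ) = krausMap (outputKraus s t ψ) Y := by
    ext x y
    rw [idTensor, of_apply, hΛ, krausMap_outputKraus_apply]
  rw [coherentInfo, h1, beamSplitterInfo, traceFst_krausMap_outputKraus, hΛ, hψ]

/-- The values of the coherent information of `N` uses of the beam splitter. -/
def infoValues (s t : ZMod d) (σ : Matrix V V ℂ) (N : ℕ) : Set ℝ :=
  {x | ∃ ψ : (Fin N → V) × (Fin N → V) → ℂ, ∑ x, ‖ψ x‖ ^ 2 = 1 ∧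
    x = beamSplitterInfo s t (tensorPow σ N) ψ}

lemma oneShotCapacity_eq {n : ℕ} {s t : ZMod d} (hst : s ^ 2 + t ^ 2 = 1)
    (σ : Matrix (Fin n → ZMod d) (Fin n → ZMod d) ℂ) (N : ℕ) :
    oneShotCapacity (tensorPower (beamSplitterChannel s t σ) N) = sSup (infoValues s t σ N) := by
  rw [oneShotCapacity]
  congr 1
  have hΛ := tensorPower_beamSplitterChannel hst σ N
  ext x
  constructor
  · rintro ⟨ρ, ψ, hρ, hψ, rfl⟩
    refine ⟨ψ, ?_, coherentInfo_eq_beamSplitterInfo hΛ hψ⟩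
    have h := hρ.2
    rw [← hψ, trace_traceFst, trace_proj] at h
    exact_mod_cast h
  · rintro ⟨ψ, hψ, rfl⟩
    refine ⟨traceFst (proj ψ), ψ, ⟨traceFst_posSemidef (proj_posSemidef ψ), ?_⟩, rfl,
      (coherentInfo_eq_beamSplitterInfo hΛ rfl).symm⟩
    rw [trace_traceFst, trace_proj, hψ, Complex.ofReal_one]

lemma infoValues_nonempty (s t : ZMod d) (σ : Matrix V V ℂ) (N : ℕ) :
    (infoValues s t σ N).Nonempty := by
  refine ⟨_, Pi.single (0, 0) 1, ?_, rfl⟩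
  rw [Finset.sum_eq_single ((0, 0) : (Fin N → V) × (Fin N → V))]
  · simp
  · intro x _ h
    simp [Pi.single_eq_of_ne h]
  · simp

lemma infoValues_le {K : Type*} [AddCommGroup K] [Module (ZMod d) K] [Fintype K] [DecidableEq K]
    {G : K → Matrix V V ℂ} (hG : IsWeylRep (d := d) G) {s t : ZMod d}
    (hst : s ^ 2 + t ^ 2 = 1) (ht : t ≠ 0) {σ : Matrix V V ℂ} (hσ : IsState σ) {D : ℝ}
    (hD : 0 < D) (htr : (invariantProj G).trace = (D : ℂ)) (hPσ : σ * invariantProj G = σ)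
    {N : ℕ} {x : ℝ} (hx : x ∈ infoValues s t σ N) :
    x ≤ N * (Real.logb 2 D - entropy σ) := by
  obtain ⟨ψ, hψ, rfl⟩ := hx
  have h := entropy_sub_entropy_le (hG.tensorPow N) hst ht (tensorPow_isState hσ N)
    (pow_pos hD N) ?_ ?_ hψ
  · rw [Real.logb_pow, entropy_tensorPow hσ, ← mul_sub] at h
    exact h
  · rw [invariantProj_tensorPow, tensorPow, trace_tensorProd, htr]
    simp
  · rw [invariantProj_tensorPow, tensorPow, tensorPow, tensorProd_mul, hPσ]

/-- Superadditivity of the coherent information: product inputs attain the sums. -/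
lemma add_mem_infoValues {s t : ZMod d} (hst : s ^ 2 + t ^ 2 = 1) {σ : Matrix V V ℂ}
    (hσ : IsState σ) {M N : ℕ} {x y : ℝ} (hx : x ∈ infoValues s t σ M)
    (hy : y ∈ infoValues s t σ N) : x + y ∈ infoValues s t σ (M + N) := by
  obtain ⟨ψ, hψ, rfl⟩ := hx
  obtain ⟨φ, hφ, rfl⟩ := hy
  set e := (Fin.appendEquiv (α := V) M N).symm with he
  let f : (Fin (M + N) → V) × (Fin (M + N) → V) ≃
      ((Fin M → V) × (Fin M → V)) × ((Fin N → V) × (Fin N → V)) :=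
    (Equiv.prodCongr e e).trans (Equiv.prodProdProdComm _ _ _ _)
  set X := krausMap (outputKraus s t ψ) (tensorPow σ M) with hX
  set Y := krausMap (outputKraus s t φ) (tensorPow σ N) with hY
  have hXp : X.PosSemidef := krausMap_posSemidef _ (tensorPow_isState hσ M).1
  have hYp : Y.PosSemidef := krausMap_posSemidef _ (tensorPow_isState hσ N).1
  have hXt : X.trace = 1 := by
    rw [hX, trace_krausMap (sum_outputKraus hst hψ), (tensorPow_isState hσ M).2]
  have hYt : Y.trace = 1 := by
    rw [hY, trace_krausMap (sum_outputKraus hst hφ), (tensorPow_isState hσ N).2]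
  refine ⟨fun z => ψ (f z).1 * φ (f z).2, ?_, ?_⟩
  · rw [Equiv.sum_comp f (fun z => ‖ψ z.1 * φ z.2‖ ^ 2), Fintype.sum_prod_type]
    simp only [norm_mul, mul_pow, ← Finset.mul_sum, hφ, mul_one, hψ]
  · have h1 : krausMap (outputKraus s t fun z => ψ (f z).1 * φ (f z).2) (tensorPow σ (M + N))
        = (X ⊗ₖ Y).submatrix f f := by
      ext z w
      rw [krausMap_outputKraus_apply, submatrix_apply, kroneckerMap_apply, hX, hY,
        krausMap_outputKraus_apply, krausMap_outputKraus_apply, conv, conv, conv, of_apply,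
        of_apply, of_apply, Finset.sum_mul_sum, ← Fintype.sum_prod_type', ← Equiv.sum_comp e]
      refine Finset.sum_congr rfl fun b _ => ?_
      rw [tensorPow_add]
      simp only [of_apply, proj, vecMulVec_apply, Pi.star_apply, submatrix_apply,
        kroneckerMap_apply, star_mul']
      have h : ∀ a b c d u v : ℂ, a * b * (c * d) * (u * v) = a * c * u * (b * d * v) := by
        intros; ring
      exact h _ _ _ _ _ _
    have h2 : traceFst ((X ⊗ₖ Y).submatrix f f) = (traceFst X ⊗ₖ traceFst Y).submatrix e e := by
      ext a b
      simp only [traceFst, of_apply, submatrix_apply, kroneckerMap_apply, Finset.sum_mul_sum]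
      rw [← Fintype.sum_prod_type', ← Equiv.sum_comp e]
      rfl
    rw [beamSplitterInfo, beamSplitterInfo, beamSplitterInfo, h1, h2, ← hX, ← hY,
      entropy_submatrix _ (hXp.kronecker hYp).isHermitian,
      entropy_submatrix _
        ((traceFst_posSemidef hXp).kronecker (traceFst_posSemidef hYp)).isHermitian,
      entropy_kronecker hXp.isHermitian hYp.isHermitian hXt hYt,
      entropy_kronecker (traceFst_posSemidef hXp).isHermitian (traceFst_posSemidef hYp).isHermitian
        (by rw [trace_traceFst, hXt]) (by rw [trace_traceFst, hYt])]
    ring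

/-- The regularized coherent information converges, by Fekete's lemma. -/
lemma exists_tendsto_sSup_infoValues {s t : ZMod d} (hst : s ^ 2 + t ^ 2 = 1)
    {σ : Matrix V V ℂ} (hσ : IsState σ) {C : ℝ}
    (hC : ∀ N, ∀ x ∈ infoValues s t σ N, x ≤ N * C) :
    ∃ Q, Filter.Tendsto (fun N : ℕ => sSup (infoValues s t σ N) / (N : ℝ)) Filter.atTop
      (nhds Q) := by
  have hbdd : ∀ N, BddAbove (infoValues s t σ N) := fun N => ⟨N * C, hC N⟩
  have hsub : Subadditive fun N => -sSup (infoValues s t σ N) := by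
    intro M N
    have h : sSup (infoValues s t σ M) ≤ sSup (infoValues s t σ (M + N))
        - sSup (infoValues s t σ N) := by
      refine csSup_le (infoValues_nonempty s t σ M) fun x hx => ?_
      have h2 : sSup (infoValues s t σ N) ≤ sSup (infoValues s t σ (M + N)) - x := by
        refine csSup_le (infoValues_nonempty s t σ N) fun y hy => ?_
        have := le_csSup (hbdd (M + N)) (add_mem_infoValues hst hσ hx hy)
        linarith
      linarith
    simp only
    linarith
  have hlow : BddBelow (Set.range fun N : ℕ => -sSup (infoValues s t σ N) / (N : ℝ)) := by
    refine ⟨min (-C) 0, ?_⟩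
    rintro _ ⟨N, rfl⟩
    rcases Nat.eq_zero_or_pos N with rfl | hN
    · simp
    · refine (min_le_left _ _).trans ?_
      have hN' : (0 : ℝ) < N := by exact_mod_cast hN
      rw [le_div_iff₀ hN']
      have := csSup_le (infoValues_nonempty s t σ N) (hC N)
      linarith
  refine ⟨-hsub.lim, ?_⟩
  have := (hsub.tendsto_lim hlow).neg
  refine this.congr fun N => ?_
  ring

lemma tendsto_sSup_infoValues_le {s t : ZMod d} {σ : Matrix V V ℂ} {C Q : ℝ}
    (hC : ∀ N, ∀ x ∈ infoValues s t σ N, x ≤ N * C)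
    (hQ : Filter.Tendsto (fun N : ℕ => sSup (infoValues s t σ N) / (N : ℝ)) Filter.atTop
      (nhds Q)) : Q ≤ C := by
  refine le_of_tendsto hQ ?_
  filter_upwards [Filter.eventually_gt_atTop 0] with N hN
  have hN' : (0 : ℝ) < N := by exact_mod_cast hN
  rw [div_le_iff₀ hN', mul_comm]
  exact csSup_le (infoValues_nonempty s t σ N) (hC N)

end Capacity

/-! ### Stabilizer states -/

lemma sq_eq_zero_or_one_of_zmod_two (x : ZMod 2) : x ^ 2 = 0 ∨ x ^ 2 = 1 := by
  revert x
  decide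

section ListProducts

variable {S F : Type*} {r : ℕ}

lemma prod_ofFn_mul [Monoid S] (a b : Fin r → S) (h : ∀ i j, Commute (b i) (a j)) :
    (List.ofFn fun i => a i * b i).prod = (List.ofFn a).prod * (List.ofFn b).prod := by
  induction r with
  | zero => simp
  | succ r ih =>
    simp only [List.ofFn_succ, List.prod_cons]
    rw [ih _ _ fun i j => h _ _]
    have hc : Commute (b 0) (List.ofFn fun i : Fin r => a i.succ).prod := by
      refine Commute.list_prod_right _ _ fun x hx => ?_
      obtain ⟨i, rfl⟩ := (List.mem_ofFn' _ _).mp hx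
      exact h _ _
    calc _ = a 0 * (b 0 * (List.ofFn fun i : Fin r => a i.succ).prod)
          * (List.ofFn fun i : Fin r => b i.succ).prod := by simp only [mul_assoc]
      _ = _ := by rw [hc.eq]; simp only [mul_assoc]

lemma prod_ofFn_sum [Semiring S] [Fintype F] (f : Fin r → F → S) :
    (List.ofFn fun i => ∑ k, f i k).prod
      = ∑ k : Fin r → F, (List.ofFn fun i => f i (k i)).prod := by
  induction r with
  | zero => simp
  | succ r ih =>
    rw [← Equiv.sum_comp (Fin.consEquiv fun _ => F), Fintype.sum_prod_type]
    simp only [List.ofFn_succ, List.prod_cons, ih, Finset.sum_mul_sum, Fin.consEquiv_apply,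
      Fin.cons_zero, Fin.cons_succ]

lemma prod_ofFn_smul {C : Type*} [CommSemiring C] [Semiring S] [Algebra C S] (c : C)
    (f : Fin r → S) :
    (List.ofFn fun i => c • f i).prod = c ^ r • (List.ofFn f).prod := by
  induction r with
  | zero => simp
  | succ r ih =>
    simp only [List.ofFn_succ, List.prod_cons, ih, smul_mul_smul_comm, pow_succ']

end ListProducts

section StabilizerStates

open Matrix

variable {d n : ℕ} [Fact d.Prime]
variable {V : Type*} [AddCommGroup V] [Module (ZMod d) V] [Fintype V] [DecidableEq V]

omit [Fintype V] in
lemma phaseShift_zero : phaseShift (0 : ZMod d) 0 (0 : V) = 1 := by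
  ext a b
  simp [phaseShift, omega_zero, Matrix.one_apply]

lemma phaseShift_pow (c : ZMod d) (l : Module.Dual (ZMod d) V) (q : V) (m : ℕ) :
    phaseShift c l q ^ m = phaseShift ((m : ZMod d) * c - (m.choose 2 : ZMod d) * l q) ((m : ZMod d) • l)
      ((m : ZMod d) • q) := by
  induction m with
  | zero => simp [phaseShift_zero]
  | succ m ih =>
    rw [pow_succ, ih, phaseShift_mul]
    congr 1
    · rw [Nat.choose_succ_succ' m 1, Nat.choose_one_right, map_smul, smul_eq_mul]
      push_cast
      ring
    · push_cast; module
    · push_cast; module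

/-- Weyl operators have order `d`, as the phase `ω^{d(d-1)/2}` is trivial for odd `d`. -/
lemma phaseShift_pow_card (hd : d ≠ 2) (c : ZMod d) (l : Module.Dual (ZMod d) V) (q : V) :
    phaseShift c l q ^ d = 1 := by
  have hp : d.Prime := Fact.out
  have h : ((d.choose 2 : ℕ) : ZMod d) = 0 :=
    (ZMod.natCast_eq_zero_iff _ _).mpr
      (hp.dvd_choose_self two_ne_zero (lt_of_le_of_ne hp.two_le hd.symm))
  rw [phaseShift_pow, h]
  simp [phaseShift_zero]

lemma exists_prod_phaseShift {r : ℕ} (c : Fin r → ZMod d) (l : Fin r → Module.Dual (ZMod d) V)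
    (q : Fin r → V) :
    ∃ c' : ZMod d, (List.ofFn fun i => phaseShift (c i) (l i) (q i)).prod
      = phaseShift c' (∑ i, l i) (∑ i, q i) := by
  induction r with
  | zero => exact ⟨0, by simp [phaseShift_zero]⟩
  | succ r ih =>
    obtain ⟨c', h⟩ := ih (fun i => c i.succ) (fun i => l i.succ) (fun i => q i.succ)
    simp only [List.ofFn_succ, List.prod_cons, h, phaseShift_mul, Fin.sum_univ_succ]
    exact ⟨_, rfl⟩

/-- The stabilizer group generated by commuting Weyl operators `g₁, …, g_r`, parametrized by the
exponents `k ∈ ℤ_d^r`. -/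
def stabilizerGroup {r : ℕ} (g : Fin r → Matrix V V ℂ) (k : Fin r → ZMod d) : Matrix V V ℂ :=
  (List.ofFn fun i => g i ^ (k i).val).prod

lemma stabilizerGroup_isWeylRep (hd : d ≠ 2) {r : ℕ} {g : Fin r → Matrix V V ℂ}
    (hg : ∀ i, ∃ c l q, g i = phaseShift (d := d) c l q) (hcomm : ∀ i j, Commute (g i) (g j)) :
    IsWeylRep (d := d) (stabilizerGroup (d := d) g) := by
  choose c l q hg using hg
  have hform : ∀ k : Fin r → ZMod d, ∃ c', stabilizerGroup g k
      = phaseShift c' (Fintype.linearCombination (ZMod d) l k)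
        (Fintype.linearCombination (ZMod d) q k) := by
    intro k
    simp only [stabilizerGroup, hg, phaseShift_pow, ZMod.natCast_zmod_val]
    exact exists_prod_phaseShift _ (fun i => k i • l i) (fun i => k i • q i)
  choose c' hc' using hform
  refine ⟨⟨fun k k' => ?_, fun k => ?_⟩, c', _, _, hc'⟩
  · have h : ∀ i, g i ^ ((k + k') i).val = g i ^ (k i).val * g i ^ (k' i).val := by
      intro i
      have h1 : g i ^ d = 1 := by rw [hg]; exact phaseShift_pow_card hd _ _ _
      rw [← pow_add, Pi.add_apply, ZMod.val_add, ← pow_eq_pow_mod _ h1]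
    rw [stabilizerGroup]
    simp only [h]
    exact prod_ofFn_mul _ _ fun i j => (hcomm i j).pow_pow _ _
  · rw [hc']
    exact phaseShift_unitary _ _ _

omit [AddCommGroup V] [Module (ZMod d) V] in
lemma invariantProj_stabilizerGroup {r : ℕ} (g : Fin r → Matrix V V ℂ) :
    invariantProj (stabilizerGroup (d := d) g)
      = (List.ofFn fun i => (d : ℂ)⁻¹ • ∑ k : ZMod d, g i ^ k.val).prod := by
  rw [prod_ofFn_smul, prod_ofFn_sum, invariantProj]
  simp [stabilizerGroup, ZMod.card]

lemma pauliX_pow (m : ℕ) :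
    pauliX d ^ m = Matrix.of fun j k : ZMod d => if j = k + m then 1 else 0 := by
  induction m with
  | zero => ext j k; simp [Matrix.one_apply]
  | succ m ih =>
    rw [pow_succ, ih]
    ext j k
    rw [mul_apply, Finset.sum_eq_single (k + 1)]
    · simp only [pauliX, of_apply, if_true, mul_one]
      push_cast
      rw [add_assoc, add_comm (1 : ZMod d)]
    · intro b _ hb
      simp [pauliX, hb]
    · simp

lemma weylOne_apply (p q a b : ZMod d) :
    weylOne p q a b = if a = b + q then omega (-(2⁻¹ * p * q) + p * a) else 0 := by
  rw [weylOne, Matrix.smul_apply, pauliX_pow, pauliZ, diagonal_pow, diagonal_mul, of_apply,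
    ZMod.natCast_zmod_val, smul_eq_mul, Pi.pow_apply, mul_ite, mul_one, mul_zero, mul_ite,
    mul_zero, omega_add]
  congr 2
  rw [omega, omega, ← AddChar.map_nsmul_eq_pow, nsmul_eq_mul, ZMod.natCast_zmod_val]

lemma exists_omega_smul_weyl (c : ZMod d) (x : (Fin n → ZMod d) × (Fin n → ZMod d)) :
    ∃ c' l q, omega c • weyl x = phaseShift (d := d) (V := Fin n → ZMod d) c' l q := by
  refine ⟨c + ∑ i, -(2⁻¹ * x.1 i * x.2 i), ∑ i, x.1 i • LinearMap.proj i, x.2, ?_⟩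
  ext a b
  simp only [Matrix.smul_apply, weyl, of_apply, weylOne_apply, phaseShift, Finset.prod_ite_zero,
    Finset.mem_univ, true_implies, smul_eq_mul, mul_ite, mul_zero, funext_iff, Pi.add_apply]
  congr 1
  rw [add_assoc, omega_add]
  congr 1
  simp only [LinearMap.sum_apply, LinearMap.smul_apply, LinearMap.proj_apply, smul_eq_mul,
    ← Finset.sum_add_distrib]
  rw [omega_sum]

omit [AddCommGroup V] in
lemma relEntropy_of_support {τ σ P : Matrix V V ℂ} {D : ℝ} (hσ : IsState σ) (hP : P.IsHermitian)
    (hPP : P * P = P) (hτ : τ = ((D⁻¹ : ℝ) : ℂ) • P)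
    (hsupp : ∀ v : V → ℂ, τ.mulVec v = 0 → σ.mulVec v = 0) :
    σ * P = σ ∧ relEntropy σ τ = ((Real.logb 2 D - entropy σ : ℝ) : EReal) := by
  have h0 : σ * (1 - P) = 0 := by
    refine Matrix.ext_of_mulVec_single fun i => ?_
    rw [← mulVec_mulVec, zero_mulVec]
    apply hsupp
    rw [mulVec_mulVec, hτ, smul_mul_assoc, mul_sub, mul_one, hPP, sub_self, smul_zero,
      zero_mulVec]
  have h1 : σ * P = σ := by
    rw [mul_sub, mul_one, sub_eq_zero] at h0
    exact h0.symm
  refine ⟨h1, ?_⟩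
  have h2 : τ = ((D⁻¹ : ℝ) : ℂ) • P + ((0 : ℝ) : ℂ) • (1 : Matrix V V ℂ) := by
    rw [hτ, Complex.ofReal_zero, zero_smul, add_zero]
  have h3 : (σ * log2 τ).trace = ((-Real.logb 2 D : ℝ) : ℂ) := by
    rw [log2, h2, cfc_smul_proj_add hP hPP, add_zero, Real.logb_zero, Complex.ofReal_zero,
      zero_smul, add_zero, mul_smul_comm, h1, trace_smul, hσ.2, smul_eq_mul, mul_one,
      Real.logb_inv]
  rw [relEntropy, if_pos hsupp, h3, Complex.sub_re, Complex.ofReal_re, entropy]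
  congr 1
  ring

end StabilizerStates

end QuditBeamSplitter

end

theorem theorem4 (d : ℕ) [Fact d.Prime] (n : ℕ) (s t : ZMod d)
    (hst : s ^ 2 + t ^ 2 = 1)
    (hs0 : s ^ 2 ≠ 0) (hs1 : s ^ 2 ≠ 1) (ht0 : t ^ 2 ≠ 0) (ht1 : t ^ 2 ≠ 1)
    (σ : Matrix (Fin n → ZMod d) (Fin n → ZMod d) ℂ)
    (hσ : QuditBeamSplitter.IsState σ) :
    ∃ Q : ℝ,
      QuditBeamSplitter.IsQuantumCapacity (QuditBeamSplitter.beamSplitterChannel s t σ) Q ∧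
      (Q : EReal) ≤ QuditBeamSplitter.MRM σ := by
  open QuditBeamSplitter in
  have hd : d ≠ 2 := by
    rintro rfl
    exact (sq_eq_zero_or_one_of_zmod_two s).elim hs0 hs1
  have ht : t ≠ 0 := fun h => ht0 (by rw [h]; ring)
  -- the trivial stabilizer group bounds the regularized coherent information
  have hG0 : IsWeylRep (d := d) (stabilizerGroup (d := d)
      (fun i : Fin 0 => (i.elim0 : Matrix (Fin n → ZMod d) (Fin n → ZMod d) ℂ))) :=
    stabilizerGroup_isWeylRep hd (fun i => i.elim0) fun i => i.elim0
  have hP0 : invariantProj (stabilizerGroup (d := d)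
      (fun i : Fin 0 => (i.elim0 : Matrix (Fin n → ZMod d) (Fin n → ZMod d) ℂ))) = 1 := by
    rw [invariantProj_stabilizerGroup]
    simp
  have hbound : ∀ N, ∀ x ∈ infoValues s t σ N,
      x ≤ N * (Real.logb 2 (Fintype.card (Fin n → ZMod d)) - entropy σ) := by
    intro N x hx
    refine infoValues_le hG0 hst ht hσ (by exact_mod_cast Fintype.card_pos) ?_ ?_ hx
    · rw [hP0, Matrix.trace_one]; norm_cast
    · rw [hP0, mul_one]
  obtain ⟨Q, hQ⟩ := exists_tendsto_sSup_infoValues hst hσ hbound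
  refine ⟨Q, hQ.congr fun N => by rw [oneShotCapacity_eq hst], ?_⟩
  refine le_sInf ?_
  rintro _ ⟨τ, ⟨hτ, r, -, x, c, g, -, hg, hcomm, hτg⟩, rfl⟩
  by_cases hsupp : ∀ v : (Fin n → ZMod d) → ℂ, τ.mulVec v = 0 → σ.mulVec v = 0
  swap
  · rw [relEntropy, if_neg hsupp]
    exact le_top
  have hG : IsWeylRep (d := d) (stabilizerGroup (d := d) g) :=
    stabilizerGroup_isWeylRep hd (fun i => by rw [hg]; exact exists_omega_smul_weyl _ _) hcomm
  rw [← invariantProj_stabilizerGroup] at hτg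
  set P := invariantProj (stabilizerGroup (d := d) g) with hPdef
  have hPi := invariantProj_eq_isotypicProj (stabilizerGroup (d := d) g)
  have hD : (0 : ℝ) < (d : ℝ) ^ (n - r) :=
    pow_pos (by exact_mod_cast (Fact.out : d.Prime).pos) _
  have hτP : τ = ((((d : ℝ) ^ (n - r))⁻¹ : ℝ) : ℂ) • P := by
    rw [hτg]; push_cast; rfl
  have htr : P.trace = (((d : ℝ) ^ (n - r) : ℝ) : ℂ) := by
    have h := hτ.2
    rw [hτP, Matrix.trace_smul, smul_eq_mul, Complex.ofReal_inv] at h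
    have hD' : (((d : ℝ) ^ (n - r) : ℝ) : ℂ) ≠ 0 := by exact_mod_cast hD.ne'
    rw [inv_mul_eq_iff_eq_mul₀ hD', mul_one] at h
    exact h
  have hPH : P.IsHermitian := by rw [hPdef, hPi]; exact hG.isotypicProj_isHermitian 0
  have hPP : P * P = P := by rw [hPdef, hPi, hG.isotypicProj_mul, if_pos rfl]
  obtain ⟨hσP, hrel⟩ := relEntropy_of_support hσ hPH hPP hτP hsupp
  rw [hrel, EReal.coe_le_coe_iff]
  exact tendsto_sSup_infoValues_le
    (fun N y hy => infoValues_le hG hst ht hσ hD htr hσP hy) hQ
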